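/- Let $d\ge 2$ and let $(X_k,Y_k)_{k\ge 0}$ be independent copies of a pair $(X,Y)$ of random vectors in $\mathbb{R}^d$ with $\mathbb{E}\|X\|_2^{4+\Delta}<\infty$ and $\mathbb{E}\|Y\|_2^{4+\Delta}<\infty$ for some $\Delta>0$. Let $\Sigma_{XY}=\mathbb{E}XY^\top=O_X\,\mathrm{diag}(\lambda_1,\dots,\lambda_d)\,O_Y^\top$ be a singular value decomposition, with $O_X,O_Y\in\mathbb{R}^{d\times d}$ orthogonal and $\lambda_1>\lambda_2\ge\cdots\ge\lambda_d>0$. For a step size $\eta>0$ and unit vectors $u_0,v_0\in\mathbb{R}^d$ consider the stochastic generalized Hebbian algorithm $$u_{k+1}=u_k+\eta\left(X_kY_k^\top v_k-(u_k^\top X_kY_k^\top v_k)\,u_k\right),\qquad v_{k+1}=v_k+\eta\left(Y_kX_k^\top u_k-(u_k^\top X_kY_k^\top v_k)\,v_k\right),$$ and put $$P=\frac1{\sqrt2}\begin{pmatrix}O_X&O_X\\O_Y&-O_Y\end{pmatrix},\qquad h_k=P^\top\frac1{\sqrt2}\begin{pmatrix}u_k\\v_k\end{pmatrix}\in\mathbb{R}^{2d},\qquad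 H_\eta(t)=h_{\lfloor t/\eta\rfloor}\quad(t\ge0).$$ Then, once the algorithm has escaped from the saddle so far that $H_\eta^{(1)}(0)=\delta$, a time $T_2\asymp\frac{1}{\lambda_1-\lambda_2}\log\frac{1-\delta^2}{\delta^2}$ suffices to reach $(H_\eta^{(1)})^2\ge1-\delta^2$ with probability at least $3/4$, if $\eta$ is small. Here $\delta$ may be fixed in $(0,1/\sqrt2)$, or depend on $\eta$ as $\delta\asymp\eta^\mu$ with $\mu\in(0,1/2)$. Precisely: for all $a>0$, $\mu\in(0,1/2)$, $b\in(0,1/\sqrt2)$ and $1<\kappa\le K$ there is $\eta_0>0$ (depending on these constants and on the law of $(X,Y)$) such that for every $\eta\in(0,\eta_0)$, every $\delta\in[a\eta^\mu,b]$, all unit vectors $u_0,v_0$ with $H_\eta^{(1)}(0)=\delta$, and every $T_2$ with $$\frac{\kappa}{\lambda_1-\lambda_2}\log\frac{1-\delta^2}{\delta^2}\ \le\ T_2\ \le\ \frac{K}{\lambda_1-\lambda_2}\log\frac{1-\delta^2}{\delta^2},$$ we have $$\mathbb{P}\left(\left(H_\eta^{(1)}(T_2)\right)^2\ge1-\delta^2\right)\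 \ge\ \frac34 .$$ -/

import Mathlib

open MeasureTheory ProbabilityTheory Matrix

noncomputable section

namespace StochGHA

/-- `ℝᵈ` with the Euclidean norm. -/
abbrev Vec (d : ℕ) := EuclideanSpace ℝ (Fin d)

/-- The cross moment matrix `Σ_XY = 𝔼 X Yᵀ` of a law `D` of the pair `(X, Y)`. -/
def crossMoment {d : ℕ} (D : Measure (Vec d × Vec d)) : Matrix (Fin d) (Fin d) ℝ :=
  Matrix.of fun i j => ∫ z, z.1 i * z.2 j ∂D

/-- One step of the stochastic generalized Hebbian algorithm with step size `η` and sample `(x, y)`: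
`u ↦ u + η (x yᵀ v - (uᵀ x yᵀ v) u)` and `v ↦ v + η (y xᵀ u - (uᵀ x yᵀ v) v)`.
Here `x yᵀ v = ⟪y, v⟫ x`, `y xᵀ u = ⟪x, u⟫ y` and `uᵀ x yᵀ v = ⟪x, u⟫ ⟪y, v⟫`. -/
def step {d : ℕ} (η : ℝ) (x y : Vec d) (p : Vec d × Vec d) : Vec d × Vec d :=
  (p.1 + η • (inner ℝ y p.2 • x - (inner ℝ x p.1 * inner ℝ y p.2) • p.1),
   p.2 + η • (inner ℝ x p.1 • y - (inner ℝ x p.1 * inner ℝ y p.2) • p.2))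

/-- The iterates `(u_k, v_k)`, started at `(u₀, v₀)` and driven by the samples `(x_k, y_k)`. -/
def iter {d : ℕ} (η : ℝ) (x y : ℕ → Vec d) (u₀ v₀ : Vec d) : ℕ → Vec d × Vec d
  | 0 => (u₀, v₀)
  | k + 1 => step η (x k) (y k) (iter η x y u₀ v₀ k)

/-- The stacked vector `w = (u, v) / √2`. -/
def stack {d : ℕ} (p : Vec d × Vec d) : Fin d ⊕ Fin d → ℝ :=
  (1 / Real.sqrt 2) • Sum.elim (fun i => p.1 i) (fun i => p.2 i)

/-- The matrix `P = (1/√2) [[O_X, O_X], [O_Y, -O_Y]]`. -/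
def rotP {d : ℕ} (OX OY : Matrix (Fin d) (Fin d) ℝ) :
    Matrix (Fin d ⊕ Fin d) (Fin d ⊕ Fin d) ℝ :=
  (1 / Real.sqrt 2) • Matrix.fromBlocks OX OX OY (-OY)

/-- The transformed coordinates `h = Pᵀ w`. Coordinate `i ≤ d` is indexed by `Sum.inl`,
coordinate `d + i` by `Sum.inr`. -/
def hCoord {d : ℕ} (OX OY : Matrix (Fin d) (Fin d) ℝ) (p : Vec d × Vec d) :
    Fin d ⊕ Fin d → ℝ :=
  (rotP OX OY)ᵀ *ᵥ stack p

/-- The rescaled process `H_η(t) = Pᵀ W_η(t) = h_{⌊t / η⌋}` in continuous time. -/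
def Hproc {d : ℕ} (OX OY : Matrix (Fin d) (Fin d) ℝ) (η : ℝ) (x y : ℕ → Vec d)
    (u₀ v₀ : Vec d) (t : ℝ) : Fin d ⊕ Fin d → ℝ :=
  hCoord OX OY (iter η x y u₀ v₀ ⌊t / η⌋₊)

end StochGHA

end

noncomputable section

namespace StochGHA

/-! In the coordinates `h` the algorithm is Oja's rule h' = h + η (A h - q h), with q = ⟪h, A h⟫,
for a random operator A whose mean is diag(λ, -λ) (`hVec_step`, `isOjaNoise_hebbOp`). Multiplying a
step by 1 + η q cancels the nonlinearity to first order: (1 + η q) h' = h + η A h + η² q (A h - q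
h). So a scalar g is carried along, with g = 1 at the start and g' = g (1 + η q) / (1 + η λ₁). The
vector y = g h then obeys a linear random recursion up to O(η²). Its leading coordinate is almost a
martingale and stays near δ. The others follow a deterministic decaying path of squared norm at most
ρ ^ k, where ρ = `contr` is the squared ratio of the growth factors 1 + η l₂ and 1 + η λ₁.

The quantity e = g² (1 - ‖h‖²) has neither drift nor noise at order η (`abs_normDev_step_le`), and
g² = ‖y‖² + e. Hence the leading coordinate of h has square y_{i₀}² / (‖y‖² + e), and it is enough
that y_{i₀} is near δ and that the transversal mass of y plus |e| is slightly below δ⁴ / (1 - δ²)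
(`one_sub_sq_le_of_dev`). The mean path provides this with a fixed factor to spare because κ > 1
(`contr_pow_floor_le`).

The noise is controlled by second moments. One step adds variance of order η² ‖y‖², and ‖y‖² is of
order δ² + ρ ^ k. Relative to δ², the leading coordinate collects N η² + η / δ². In the transversal
ones older noise is contracted, which leaves a multiple of (η / δ²) δ⁴. Both are negligible as soon
as η / δ² is small, which is where μ < 1/2 enters. Two applications of Markov's inequality, each
with failure probability 1/8, give 3/4.

Only the second moment of n = ‖X‖ ‖Y‖ is available. So g is set to 0 when η n > 1/4, which costs at
most 16 η² 𝔼 n² per step, and on the complement higher powers of η n reduce to squares. -/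

/-- A random operator `A` on `ℝ^ι` with `‖A z h‖ ≤ n z ‖h‖`, `𝔼 n² ≤ M` and mean `diag lam`, whose
top eigenvalue `lam i₀` is separated from the others by `l₂ ∈ (0, lam i₀)`. -/
structure IsOjaNoise {ι Z : Type*} [Fintype ι] [MeasurableSpace Z] (ν : Measure Z)
    (A : Z → EuclideanSpace ℝ ι →ₗ[ℝ] EuclideanSpace ℝ ι) (n : Z → ℝ) (lam : ι → ℝ) (i₀ : ι)
    (l₂ M : ℝ) : Prop where
  measurable_A : Measurable fun p : EuclideanSpace ℝ ι × Z => A p.2 p.1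
  measurable_n : Measurable n
  n_nonneg : ∀ z, 0 ≤ n z
  norm_le : ∀ z h, ‖A z h‖ ≤ n z * ‖h‖
  integrable_sq : Integrable (fun z => n z ^ 2) ν
  integral_sq_le : ∫ z, n z ^ 2 ∂ν ≤ M
  mean : ∀ h i, ∫ z, A z h i ∂ν = lam i * h i
  l₂_pos : 0 < l₂
  l₂_lt : l₂ < lam i₀
  lam_le : ∀ i, i ≠ i₀ → lam i ≤ l₂
  neg_le : ∀ i, -lam i₀ ≤ lam i

/-! ### One step of the rescaled recursion: pathwise bounds and moment majorants. -/

section OneStep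

set_option linter.unusedSectionVars false

variable {ι : Type*} [Fintype ι] [DecidableEq ι] {Z : Type*} [MeasurableSpace Z]

/-- One step of Oja's rule with operator `T`. -/
def ojaStep (η : ℝ) (T : EuclideanSpace ℝ ι →ₗ[ℝ] EuclideanSpace ℝ ι) (h : EuclideanSpace ℝ ι) :
    EuclideanSpace ℝ ι :=
  h + η • (T h - (inner ℝ h (T h) : ℝ) • h)

/-- The rescaled deviation of the norm of `h` from `1`. -/
def normDev (s : EuclideanSpace ℝ ι × ℝ) : ℝ := s.2 ^ 2 * (1 - ‖s.1‖ ^ 2)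

/-- The deviation of the leading rescaled coordinate from `δ`, plus that of the norm. -/
def leadDev (i₀ : ι) (δ : ℝ) (s : EuclideanSpace ℝ ι × ℝ) : ℝ :=
  (s.2 * s.1 i₀ - δ) ^ 2 + |normDev s|

/-- The mean path of the rescaled coordinates. -/
def meanPath (lam : ι → ℝ) (i₀ : ι) (η : ℝ) (h₀ : EuclideanSpace ℝ ι) (k : ℕ) (i : ι) : ℝ :=
  ((1 + η * lam i) / (1 + η * lam i₀)) ^ k * h₀ i

/-- The deviation of the other rescaled coordinates from their mean path, plus that of the norm. -/
def transDev (lam : ι → ℝ) (i₀ : ι) (η : ℝ) (h₀ : EuclideanSpace ℝ ι) (k : ℕ)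
    (s : EuclideanSpace ℝ ι × ℝ) : ℝ :=
  ∑ i ∈ Finset.univ.erase i₀, (s.2 * s.1 i - meanPath lam i₀ η h₀ k i) ^ 2 + |normDev s|

/-- Oja's rule together with the rescaling factor, which is set to `0` once the leading coordinate
or the norm has deviated, or the operator was large. -/
def scaledStep (A : Z → EuclideanSpace ℝ ι →ₗ[ℝ] EuclideanSpace ℝ ι) (n : Z → ℝ) (lam : ι → ℝ)
    (i₀ : ι) (c η δ : ℝ) (s : EuclideanSpace ℝ ι × ℝ) (z : Z) : EuclideanSpace ℝ ι × ℝ :=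
  open Classical in
  (ojaStep η (A z) s.1,
    if leadDev i₀ δ s ≤ c * δ ^ 2 ∧ η * n z ≤ 1 / 4 then
      s.2 * (1 + η * (inner ℝ s.1 (A z s.1) : ℝ)) / (1 + η * lam i₀) else 0)

/-- The squared contraction rate of the transversal coordinates. -/
def contr (l₁ l₂ η : ℝ) : ℝ := ((1 + η * l₂) / (1 + η * l₁)) ^ 2

lemma abs_apply_le_norm (y : EuclideanSpace ℝ ι) (i : ι) : |y i| ≤ ‖y‖ := by
  simpa using PiLp.norm_apply_le y i

lemma normDev_add_norm_sq (s : EuclideanSpace ℝ ι × ℝ) :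
    normDev s + ‖s.2 • s.1‖ ^ 2 = s.2 ^ 2 := by
  rw [normDev, norm_smul, mul_pow, Real.norm_eq_abs, sq_abs]; ring

lemma norm_sq_eq_add (i₀ : ι) (y : EuclideanSpace ℝ ι) :
    ‖y‖ ^ 2 = y i₀ ^ 2 + ∑ i ∈ Finset.univ.erase i₀, y i ^ 2 := by
  rw [EuclideanSpace.real_norm_sq_eq, Finset.add_sum_erase _ (fun i => y i ^ 2) (Finset.mem_univ i₀)]

/-- Here α is a coordinate of A y, β its mean, w the coordinate of y, and s the Rayleigh quotient.
For η n ≤ 1/4 the terms of the square beyond n² are absorbed into n². The right side must be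
nonnegative for large n as well, because it is later integrated without truncation. -/
lemma scalar_majorant {η n l p α β w s Y : ℝ} (hη : 0 < η) (hn : 0 ≤ n)
    (hηl : η * l ≤ 1) (hα : |α| ≤ n * Y) (hβ : |β| ≤ l * Y) (hw : |w| ≤ Y) (hs : |s| ≤ 2 * n)
    (hY : 0 ≤ Y) :
    0 ≤ p ^ 2 + 2 * η * p * (α - β) + η ^ 2 * (52 * n ^ 2 * (|p| * Y) +
      (13 * n ^ 2 + 2 * l ^ 2) * Y ^ 2) ∧
    (η * n ≤ 1 / 4 → (p + η * (α - β) + η ^ 2 * s * (α - s * w)) ^ 2 ≤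
      p ^ 2 + 2 * η * p * (α - β) + η ^ 2 * (52 * n ^ 2 * (|p| * Y) +
      (13 * n ^ 2 + 2 * l ^ 2) * Y ^ 2)) := by
  have key : η * n ≤ 1 / 4 → (p + η * (α - β) + η ^ 2 * s * (α - s * w)) ^ 2 ≤
      p ^ 2 + 2 * η * p * (α - β) + η ^ 2 * (52 * n ^ 2 * (|p| * Y) +
      (13 * n ^ 2 + 2 * l ^ 2) * Y ^ 2) := by
    intro hn4
    have h1 : |α - s * w| ≤ 3 * n * Y := by
      calc |α - s * w| ≤ |α| + |s * w| := abs_sub _ _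
        _ ≤ n * Y + 2 * n * Y := by rw [abs_mul]; gcongr
        _ = _ := by ring
    have h2 : |s * (α - s * w)| ≤ 6 * n ^ 2 * Y := by
      rw [abs_mul]
      calc |s| * |α - s * w| ≤ 2 * n * (3 * n * Y) := by gcongr
        _ = _ := by ring
    have h3 : p * (s * (α - s * w)) ≤ 6 * n ^ 2 * (|p| * Y) := by
      calc p * (s * (α - s * w)) ≤ |p * (s * (α - s * w))| := le_abs_self _
        _ ≤ |p| * (6 * n ^ 2 * Y) := by rw [abs_mul]; gcongr
        _ = _ := by ring
    have h4 : |(α - β) + η * (s * (α - s * w))| ≤ (5 / 2 * n + l) * Y := by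
      have hab : |α - β| ≤ |α| + |β| := abs_sub _ _
      calc |(α - β) + η * (s * (α - s * w))| ≤ |α - β| + |η * (s * (α - s * w))| := abs_add_le _ _
        _ ≤ (n * Y + l * Y) + η * (6 * n ^ 2 * Y) := by
          rw [abs_mul, abs_of_pos hη]; gcongr; linarith
        _ = (n * Y + l * Y) + (η * n) * (6 * n * Y) := by ring
        _ ≤ (n * Y + l * Y) + 1 / 4 * (6 * n * Y) := by gcongr
        _ = _ := by ring
    have h5 : ((α - β) + η * (s * (α - s * w))) ^ 2 ≤ (13 * n ^ 2 + 2 * l ^ 2) * Y ^ 2 := by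
      calc _ = |(α - β) + η * (s * (α - s * w))| ^ 2 := (sq_abs _).symm
        _ ≤ ((5 / 2 * n + l) * Y) ^ 2 := by gcongr
        _ = (5 / 2 * n + l) ^ 2 * Y ^ 2 := by ring
        _ ≤ _ := by
          gcongr
          nlinarith [sq_nonneg (5 / 2 * n - l)]
    calc _ = p ^ 2 + 2 * η * p * (α - β) + η ^ 2 * (2 * (p * (s * (α - s * w))) +
          ((α - β) + η * (s * (α - s * w))) ^ 2) := by ring
      _ ≤ p ^ 2 + 2 * η * p * (α - β) + η ^ 2 * (2 * (6 * n ^ 2 * (|p| * Y)) +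
          (13 * n ^ 2 + 2 * l ^ 2) * Y ^ 2) := by gcongr
      _ ≤ _ := by
        have : 0 ≤ n ^ 2 * (|p| * Y) := by positivity
        nlinarith [mul_nonneg (sq_nonneg η) this]
  refine ⟨?_, key⟩
  rcases le_or_gt (η * n) (1 / 4) with h | h
  · exact (sq_nonneg _).trans (key h)
  · have h1 : |p * (α - β)| ≤ |p| * ((n + l) * Y) := by
      rw [abs_mul]; gcongr
      calc |α - β| ≤ |α| + |β| := abs_sub _ _
        _ ≤ _ := by linarith
    -- From η n > 1/4 follow η n ≤ 4 (η n)² and η l ≤ 1 ≤ 16 (η n)². Doubled, this 20 adds 40 to the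
    -- coefficient 12 needed for small n; hence 52.
    have h2 : η * (n + l) ≤ 20 * (η * n) ^ 2 := by nlinarith
    have h3 : η * (|p| * ((n + l) * Y)) ≤ 20 * (η * n) ^ 2 * (|p| * Y) := by
      calc _ = η * (n + l) * (|p| * Y) := by ring
        _ ≤ _ := by gcongr
    have h4 : -(η * (|p| * ((n + l) * Y))) ≤ η * (p * (α - β)) := by
      rw [← mul_neg]; gcongr; exact neg_le_of_abs_le h1
    have h5 : 0 ≤ η ^ 2 * ((13 * n ^ 2 + 2 * l ^ 2) * Y ^ 2) := by positivity
    have h6 : 0 ≤ (η * n) ^ 2 * (|p| * Y) := by positivity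
    nlinarith [sq_nonneg p]

variable {ν : Measure Z} [IsProbabilityMeasure ν]
  {A : Z → EuclideanSpace ℝ ι →ₗ[ℝ] EuclideanSpace ℝ ι} {n : Z → ℝ} {lam : ι → ℝ} {i₀ : ι}
  {l₂ M : ℝ}

namespace IsOjaNoise

lemma l₁_pos (H : IsOjaNoise ν A n lam i₀ l₂ M) : 0 < lam i₀ := H.l₂_pos.trans H.l₂_lt

lemma M_nonneg (H : IsOjaNoise ν A n lam i₀ l₂ M) : 0 ≤ M :=
  (integral_nonneg fun z => sq_nonneg (n z)).trans H.integral_sq_le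

lemma abs_lam_le (H : IsOjaNoise ν A n lam i₀ l₂ M) (i : ι) : |lam i| ≤ lam i₀ := by
  rw [abs_le]
  refine ⟨H.neg_le i, ?_⟩
  by_cases h : i = i₀
  · rw [h]
  · exact (H.lam_le i h).trans H.l₂_lt.le

lemma measurable_apply (H : IsOjaNoise ν A n lam i₀ l₂ M) (y : EuclideanSpace ℝ ι) (i : ι) :
    Measurable fun z => A z y i := by
  have h1 : Measurable fun z => A z y := H.measurable_A.comp (measurable_const.prodMk measurable_id)
  fun_prop

lemma integrable_apply (H : IsOjaNoise ν A n lam i₀ l₂ M) (y : EuclideanSpace ℝ ι) (i : ι) :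
    Integrable (fun z => A z y i) ν := by
  refine Integrable.mono' (g := fun z => (1 + n z ^ 2) * ‖y‖)
    (((integrable_const _).add H.integrable_sq).mul_const _)
    (H.measurable_apply y i).aestronglyMeasurable (.of_forall fun z => ?_)
  calc ‖A z y i‖ ≤ ‖A z y‖ := PiLp.norm_apply_le _ _
    _ ≤ n z * ‖y‖ := H.norm_le z y
    _ ≤ _ := by gcongr; nlinarith [sq_nonneg (n z - 1)]

/-- The square is needed only where η n ≤ 1/4, but restricting to that event would destroy the mean
zero of the linear term. The majorant keeps the linear term on the whole space, so that it
integrates to 0 and only O(η²) is left. -/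
lemma exists_majorant (H : IsOjaNoise ν A n lam i₀ l₂ M) {η : ℝ} (hη : 0 < η)
    (hη1 : η * lam i₀ ≤ 1) (y : EuclideanSpace ℝ ι) (i : ι) (p : ℝ) :
    ∃ G : Z → ℝ, Integrable G ν ∧
      ∫ z, G z ∂ν ≤ p ^ 2 + (39 * M + 2 * lam i₀ ^ 2) * η ^ 2 * (p ^ 2 + ‖y‖ ^ 2) ∧
      (∀ z, 0 ≤ G z) ∧
      ∀ z s, |s| ≤ 2 * n z → η * n z ≤ 1 / 4 →
        (p + η * (A z y i - lam i * y i) + η ^ 2 * s * (A z y i - s * y i)) ^ 2 ≤ G z := by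
  have hbd := fun z (s : ℝ) (hs : |s| ≤ 2 * n z) => scalar_majorant (p := p) (α := A z y i)
    (β := lam i * y i) (w := y i) (l := lam i₀) (Y := ‖y‖) hη (H.n_nonneg z) hη1
    ((abs_apply_le_norm _ _).trans (H.norm_le z y))
    (by rw [abs_mul]
        exact mul_le_mul (H.abs_lam_le i) (abs_apply_le_norm _ _) (abs_nonneg _) H.l₁_pos.le)
    (abs_apply_le_norm _ _) hs (norm_nonneg _)
  refine ⟨_, ?_, ?_, fun z => (hbd z 0 (by simpa using H.n_nonneg z)).1,
    fun z s hs => (hbd z s hs).2⟩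
  · have h1 := H.integrable_apply y i
    have h2 := H.integrable_sq
    fun_prop
  · have h1 := H.integrable_apply y i
    have h2 := H.integrable_sq
    have h3 : ∀ z, p ^ 2 + 2 * η * p * (A z y i - lam i * y i) + η ^ 2 * (52 * n z ^ 2 *
        (|p| * ‖y‖) + (13 * n z ^ 2 + 2 * lam i₀ ^ 2) * ‖y‖ ^ 2) =
        (p ^ 2 - 2 * η * p * (lam i * y i) + η ^ 2 * (2 * lam i₀ ^ 2 * ‖y‖ ^ 2)) +
        (2 * η * p) * A z y i + (η ^ 2 * (52 * (|p| * ‖y‖) + 13 * ‖y‖ ^ 2)) * n z ^ 2 :=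
      fun z => by ring
    simp_rw [h3]
    rw [integral_add (by fun_prop) (by fun_prop), integral_add (by fun_prop) (by fun_prop),
      integral_const_mul, integral_const_mul, H.mean]
    -- This halves 52 to 26; with the 13 from the quadratic term it makes 39.
    have h4 : |p| * ‖y‖ ≤ (p ^ 2 + ‖y‖ ^ 2) / 2 := by
      nlinarith [sq_nonneg (|p| - ‖y‖), sq_abs p]
    have h5 : (η ^ 2 * (52 * (|p| * ‖y‖) + 13 * ‖y‖ ^ 2)) * ∫ z, n z ^ 2 ∂ν ≤
        (η ^ 2 * (52 * ((p ^ 2 + ‖y‖ ^ 2) / 2) + 13 * (p ^ 2 + ‖y‖ ^ 2))) * M := by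
      have := H.M_nonneg
      have := H.integral_sq_le
      gcongr
      nlinarith [sq_nonneg p]
    have h6 : η ^ 2 * (2 * lam i₀ ^ 2 * ‖y‖ ^ 2) ≤
        η ^ 2 * (2 * lam i₀ ^ 2 * (p ^ 2 + ‖y‖ ^ 2)) := by
      gcongr; nlinarith [sq_nonneg p]
    simp only [integral_const, probReal_univ, one_smul]
    linarith

end IsOjaNoise

/-- The constant of the one-step moment bounds. -/
def noiseConst (ι : Type*) [Fintype ι] (l₁ M : ℝ) : ℝ :=
  3 * (Fintype.card ι * (39 * M + 2 * l₁ ^ 2) + 37 * M) + (39 * M + 2 * l₁ ^ 2) + 16 * M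

/-- With c ≤ 1/16 the leading coordinate of y is within δ/4 of δ, and |e| ≤ δ²/16 is at most half of
‖y‖² ≥ (3δ/4)². Then g² = ‖y‖² + e ≥ ‖y‖²/2 = g² ‖h‖²/2 bounds ‖h‖². -/
lemma alive_bounds {i₀ : ι} {c δ : ℝ} (hc : c ≤ 1 / 16) (hδ : 0 < δ)
    {s : EuclideanSpace ℝ ι × ℝ} (hs : leadDev i₀ δ s ≤ c * δ ^ 2) :
    3 / 4 * δ ≤ s.2 * s.1 i₀ ∧ (s.2 * s.1 i₀) ^ 2 ≤ 3 * δ ^ 2 ∧ ‖s.1‖ ^ 2 ≤ 2 ∧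
      |normDev s| ≤ ‖s.2 • s.1‖ ^ 2 := by
  have h0 : leadDev i₀ δ s ≤ (δ / 4) ^ 2 := by nlinarith
  have h1 : (s.2 * s.1 i₀ - δ) ^ 2 ≤ (δ / 4) ^ 2 := (le_add_of_nonneg_right (abs_nonneg _)).trans h0
  have h2 : |normDev s| ≤ (δ / 4) ^ 2 := (le_add_of_nonneg_left (sq_nonneg _)).trans h0
  have h3 := abs_le_of_sq_le_sq' h1 (by positivity)
  have h4 : 3 / 4 * δ ≤ s.2 * s.1 i₀ := by linarith
  have h5 : (3 / 4 * δ) ^ 2 ≤ ‖s.2 • s.1‖ ^ 2 := by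
    have := norm_sq_eq_add i₀ (s.2 • s.1)
    have h6 : 0 ≤ ∑ i ∈ Finset.univ.erase i₀, (s.2 • s.1) i ^ 2 :=
      Finset.sum_nonneg fun i _ => sq_nonneg _
    have h7 : (s.2 • s.1) i₀ = s.2 * s.1 i₀ := rfl
    have h8 : (3 / 4 * δ) ^ 2 ≤ (s.2 * s.1 i₀) ^ 2 := by gcongr
    rw [h7] at this; linarith
  have h6 : |normDev s| ≤ ‖s.2 • s.1‖ ^ 2 / 2 := by nlinarith
  refine ⟨h4, ?_, ?_, by linarith [sq_nonneg ‖s.2 • s.1‖]⟩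
  · have : (s.2 * s.1 i₀) ^ 2 ≤ (5 / 4 * δ) ^ 2 :=
      pow_le_pow_left₀ (by linarith) (by linarith) 2
    nlinarith
  · have h7 := normDev_add_norm_sq s
    have h8 : ‖s.2 • s.1‖ ^ 2 = s.2 ^ 2 * ‖s.1‖ ^ 2 := by
      rw [norm_smul, mul_pow, Real.norm_eq_abs, sq_abs]
    have h9 : ‖s.2 • s.1‖ ^ 2 ≤ 2 * s.2 ^ 2 := by linarith [neg_abs_le (normDev s)]
    have h10 : 0 < s.2 ^ 2 := by
      have : s.2 ≠ 0 := by rintro h; rw [h] at h4; linarith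
      positivity
    rw [h8] at h9; nlinarith

lemma abs_inner_le {T : EuclideanSpace ℝ ι →ₗ[ℝ] EuclideanSpace ℝ ι} {n : ℝ}
    (hT : ∀ h, ‖T h‖ ≤ n * ‖h‖) {h : EuclideanSpace ℝ ι} (hn : 0 ≤ n) (hh : ‖h‖ ^ 2 ≤ 2) :
    |(inner ℝ h (T h) : ℝ)| ≤ 2 * n := by
  calc _ ≤ ‖h‖ * ‖T h‖ := abs_real_inner_le_norm _ _
    _ ≤ ‖h‖ * (n * ‖h‖) := by gcongr; exact hT h
    _ = n * ‖h‖ ^ 2 := by ring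
    _ ≤ n * 2 := by gcongr
    _ = _ := by ring

/-- Oja's step multiplies 1 - ‖h‖² by 1 - 2 η q up to O(η²), and (1 + x)² (1 - 2 x) = 1 - 3 x² - 2
x³ has no linear term. The constant 37 covers 16 from this factor and 81/4 from the squared
increment. -/
lemma abs_normDev_step_le {T : EuclideanSpace ℝ ι →ₗ[ℝ] EuclideanSpace ℝ ι} {n η : ℝ}
    (hT : ∀ h, ‖T h‖ ≤ n * ‖h‖) {s : EuclideanSpace ℝ ι × ℝ} (hn : 0 ≤ n) (hη : 0 < η)
    (hηn : η * n ≤ 1 / 4) (hh : ‖s.1‖ ^ 2 ≤ 2) (he : |normDev s| ≤ ‖s.2 • s.1‖ ^ 2) :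
    |normDev (ojaStep η T s.1, s.2 * (1 + η * (inner ℝ s.1 (T s.1) : ℝ)))| ≤
      |normDev s| + 37 * η ^ 2 * n ^ 2 * ‖s.2 • s.1‖ ^ 2 := by
  obtain ⟨h, g⟩ := s
  dsimp only at hh he ⊢
  set q : ℝ := inner ℝ h (T h) with hq
  have hq2 : |q| ≤ 2 * n := abs_inner_le hT hn hh
  have hηq : |η * q| ≤ 1 / 2 := by rw [abs_mul, abs_of_pos hη]; nlinarith
  have h1 : ‖ojaStep η T h‖ ^ 2 =
      ‖h‖ ^ 2 + 2 * η * q * (1 - ‖h‖ ^ 2) + η ^ 2 * ‖T h - q • h‖ ^ 2 := by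
    rw [ojaStep, norm_add_sq_real, inner_smul_right, inner_sub_right, inner_smul_right,
      real_inner_self_eq_norm_sq, norm_smul, mul_pow, Real.norm_eq_abs, sq_abs, ← hq]
    ring
  have h2 : normDev (ojaStep η T h, g * (1 + η * q)) =
      normDev (h, g) * (1 - 3 * (η * q) ^ 2 - 2 * (η * q) ^ 3) -
      η ^ 2 * (1 + η * q) ^ 2 * (g ^ 2 * ‖T h - q • h‖ ^ 2) := by
    simp only [normDev, h1]; ring
  have h3 : ‖T h - q • h‖ ≤ 3 * n * ‖h‖ := by
    calc _ ≤ ‖T h‖ + ‖q • h‖ := norm_sub_le _ _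
      _ ≤ n * ‖h‖ + 2 * n * ‖h‖ := by
        rw [norm_smul, Real.norm_eq_abs]
        gcongr
        exact hT h
      _ = _ := by ring
  have hy : ‖g • h‖ ^ 2 = g ^ 2 * ‖h‖ ^ 2 := by
    rw [norm_smul, mul_pow, Real.norm_eq_abs, sq_abs]
  have h4 : g ^ 2 * ‖T h - q • h‖ ^ 2 ≤ 9 * n ^ 2 * ‖g • h‖ ^ 2 := by
    calc _ ≤ g ^ 2 * (3 * n * ‖h‖) ^ 2 := by gcongr
      _ = _ := by rw [hy]; ring
  obtain ⟨ha, hb⟩ := abs_le.1 hηq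
  have h5 : (η * q) ^ 2 ≤ 4 * (η ^ 2 * n ^ 2) := by
    rw [mul_pow, ← sq_abs q]
    have : |q| ^ 2 ≤ (2 * n) ^ 2 := by gcongr
    nlinarith [sq_nonneg η]
  have h6 : |1 - 3 * (η * q) ^ 2 - 2 * (η * q) ^ 3| ≤ 1 + 16 * (η ^ 2 * n ^ 2) := by
    rw [abs_le]
    constructor <;> nlinarith [sq_nonneg (η * q)]
  have h7 : (1 + η * q) ^ 2 ≤ 9 / 4 := by nlinarith
  have h8 : 0 ≤ η ^ 2 * n ^ 2 := by positivity
  rw [h2]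
  calc _ ≤ |normDev (h, g) * (1 - 3 * (η * q) ^ 2 - 2 * (η * q) ^ 3)| +
        |η ^ 2 * (1 + η * q) ^ 2 * (g ^ 2 * ‖T h - q • h‖ ^ 2)| := abs_sub _ _
    _ ≤ |normDev (h, g)| * (1 + 16 * (η ^ 2 * n ^ 2)) +
        η ^ 2 * (9 / 4) * (9 * n ^ 2 * ‖g • h‖ ^ 2) := by
      rw [abs_mul, abs_of_nonneg (a := η ^ 2 * (1 + η * q) ^ 2 * _) (by positivity)]
      gcongr
    _ ≤ _ := by nlinarith [mul_nonneg h8 (sq_nonneg ‖g • h‖), mul_le_mul_of_nonneg_left he h8]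

/-- The cancellation behind the whole proof: after rescaling, the nonlinearity appears only with η².
-/
lemma scaled_apply_step (T : EuclideanSpace ℝ ι →ₗ[ℝ] EuclideanSpace ℝ ι) (η l : ℝ)
    (h : EuclideanSpace ℝ ι) (g : ℝ) (i : ι) :
    g * (1 + η * (inner ℝ h (T h) : ℝ)) * ojaStep η T h i =
      (1 + η * l) * (g * h i) + η * (T (g • h) i - l * (g • h) i) +
        η ^ 2 * (inner ℝ h (T h) : ℝ) *
          (T (g • h) i - (inner ℝ h (T h) : ℝ) * (g • h) i) := by
  simp only [ojaStep, map_smul, PiLp.add_apply, PiLp.smul_apply, PiLp.sub_apply, smul_eq_mul]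
  ring

lemma leadDev_nonneg (i₀ : ι) (δ : ℝ) (s : EuclideanSpace ℝ ι × ℝ) : 0 ≤ leadDev i₀ δ s := by
  unfold leadDev; positivity

lemma transDev_nonneg (lam : ι → ℝ) (i₀ : ι) (η : ℝ) (h₀ : EuclideanSpace ℝ ι) (k : ℕ)
    (s : EuclideanSpace ℝ ι × ℝ) : 0 ≤ transDev lam i₀ η h₀ k s := by
  unfold transDev; positivity

/-- The leading deviation relative to its threshold, `1` once above the threshold. -/
def leadPot (i₀ : ι) (c δ : ℝ) (s : EuclideanSpace ℝ ι × ℝ) : ℝ :=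
  open Classical in
  if leadDev i₀ δ s ≤ c * δ ^ 2 then leadDev i₀ δ s / (c * δ ^ 2) else 1

/-- The transversal deviation as long as the leading one is below the threshold. -/
def transPot (lam : ι → ℝ) (i₀ : ι) (c η δ : ℝ) (h₀ : EuclideanSpace ℝ ι) (k : ℕ)
    (s : EuclideanSpace ℝ ι × ℝ) : ℝ :=
  open Classical in
  if leadDev i₀ δ s ≤ c * δ ^ 2 then transDev lam i₀ η h₀ k s else 0

lemma leadPot_le_one {i₀ : ι} {c δ : ℝ} (hc : 0 < c) (hδ : 0 < δ) (s : EuclideanSpace ℝ ι × ℝ) :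
    leadPot i₀ c δ s ≤ 1 := by
  unfold leadPot
  split_ifs with h
  · exact div_le_one_of_le₀ h (by positivity)
  · exact le_rfl

lemma leadPot_le {i₀ : ι} {c δ : ℝ} (hc : 0 < c) (hδ : 0 < δ) (s : EuclideanSpace ℝ ι × ℝ) :
    leadPot i₀ c δ s ≤ leadDev i₀ δ s / (c * δ ^ 2) := by
  unfold leadPot
  split_ifs with h
  · exact le_rfl
  · rw [le_div_iff₀ (by positivity)]; linarith

lemma transPot_nonneg (lam : ι → ℝ) (i₀ : ι) (c η δ : ℝ) (h₀ : EuclideanSpace ℝ ι) (k : ℕ)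
    (s : EuclideanSpace ℝ ι × ℝ) : 0 ≤ transPot lam i₀ c η δ h₀ k s := by
  unfold transPot
  split_ifs
  · exact transDev_nonneg ..
  · exact le_rfl

lemma transPot_le (lam : ι → ℝ) (i₀ : ι) (c η δ : ℝ) (h₀ : EuclideanSpace ℝ ι) (k : ℕ)
    (s : EuclideanSpace ℝ ι × ℝ) : transPot lam i₀ c η δ h₀ k s ≤ transDev lam i₀ η h₀ k s := by
  unfold transPot
  split_ifs
  · exact le_rfl
  · exact transDev_nonneg ..

/-- At scale 0 the leading deviation is δ² itself, so a killed chain stays above the threshold for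
ever. -/
lemma not_leadDev_le_of_eq_zero {i₀ : ι} {c δ : ℝ} (hc : c ≤ 1 / 16) (hδ : 0 < δ)
    (h : EuclideanSpace ℝ ι) : ¬ leadDev i₀ δ (h, 0) ≤ c * δ ^ 2 := by
  simp only [leadDev, normDev]
  have : 0 < δ ^ 2 := by positivity
  simp; nlinarith

end OneStep

/-! ### Drift inequalities for the two potentials. -/

section Drift

set_option linter.unusedSectionVars false

variable {ι : Type*} [Fintype ι] [DecidableEq ι] {Z : Type*} [MeasurableSpace Z]
  {ν : Measure Z} [IsProbabilityMeasure ν]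
  {A : Z → EuclideanSpace ℝ ι →ₗ[ℝ] EuclideanSpace ℝ ι} {n : Z → ℝ} {lam : ι → ℝ} {i₀ : ι}
  {l₂ M : ℝ}

lemma lintegral_ofReal_le {f G : Z → ℝ} {C : ℝ} (hG : Integrable G ν) (h0 : ∀ z, 0 ≤ G z)
    (hf : ∀ z, f z ≤ G z) (hC : ∫ z, G z ∂ν ≤ C) :
    ∫⁻ z, ENNReal.ofReal (f z) ∂ν ≤ ENNReal.ofReal C := by
  calc _ ≤ ∫⁻ z, ENNReal.ofReal (G z) ∂ν :=
        lintegral_mono fun z => ENNReal.ofReal_le_ofReal (hf z)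
    _ = ENNReal.ofReal (∫ z, G z ∂ν) :=
        (ofReal_integral_eq_lintegral_ofReal hG (.of_forall h0)).symm
    _ ≤ _ := ENNReal.ofReal_le_ofReal hC

lemma normDev_div (h : EuclideanSpace ℝ ι) (g r : ℝ) :
    |normDev (h, g / r)| = |normDev (h, g)| / r ^ 2 := by
  have : normDev (h, g / r) = normDev (h, g) / r ^ 2 := by simp only [normDev]; ring
  rw [this, abs_div, abs_of_nonneg (sq_nonneg r)]

lemma contr_nonneg (l₁ l₂ η : ℝ) : 0 ≤ contr l₁ l₂ η := sq_nonneg _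

/-- The bounds λ_i ≥ -λ₁ and η λ₁ ≤ 1 give 0 ≤ 1 + η λ_i ≤ 1 + η l₂, so negative eigenvalues
contract at least as fast. -/
lemma sum_sq_meanPath_le (H : IsOjaNoise ν A n lam i₀ l₂ M) {η : ℝ} (hη : 0 < η)
    (hη1 : η * lam i₀ ≤ 1) (h₀ : EuclideanSpace ℝ ι) (k : ℕ) :
    ∑ i ∈ Finset.univ.erase i₀, meanPath lam i₀ η h₀ k i ^ 2 ≤
      contr (lam i₀) l₂ η ^ k * (‖h₀‖ ^ 2 - h₀ i₀ ^ 2) := by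
  rw [norm_sq_eq_add i₀ h₀, add_sub_cancel_left, Finset.mul_sum]
  have := H.l₁_pos
  refine Finset.sum_le_sum fun i hi => ?_
  rw [meanPath, mul_pow, ← pow_mul, mul_comm k 2, pow_mul, contr]
  have h1 : 0 ≤ 1 + η * lam i := by nlinarith [H.neg_le i]
  have h2 := H.lam_le i (Finset.ne_of_mem_erase hi)
  gcongr

/-- The variance added by a step is proportional to ‖y‖². This bound makes it decay with the mean
path instead of staying of order 1. -/
lemma norm_sq_le_of_alive (H : IsOjaNoise ν A n lam i₀ l₂ M) {η c δ : ℝ} (hη : 0 < η)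
    (hη1 : η * lam i₀ ≤ 1) (hc : c ≤ 1 / 16) (hδ : 0 < δ) {h₀ : EuclideanSpace ℝ ι}
    (hh₀ : ‖h₀‖ = 1) (k : ℕ) {s : EuclideanSpace ℝ ι × ℝ} (hs : leadDev i₀ δ s ≤ c * δ ^ 2) :
    ‖s.2 • s.1‖ ^ 2 ≤ 3 * δ ^ 2 + 2 * transDev lam i₀ η h₀ k s +
      2 * contr (lam i₀) l₂ η ^ k := by
  have h1 := (alive_bounds hc hδ hs).2.1
  have h2 := sum_sq_meanPath_le H hη hη1 h₀ k
  have h3 : contr (lam i₀) l₂ η ^ k * (‖h₀‖ ^ 2 - h₀ i₀ ^ 2) ≤ contr (lam i₀) l₂ η ^ k := by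
    rw [hh₀]
    exact mul_le_of_le_one_right (pow_nonneg (contr_nonneg ..) _) (by nlinarith [sq_nonneg (h₀ i₀)])
  have h4 : ∑ i ∈ Finset.univ.erase i₀, (s.2 • s.1) i ^ 2 ≤
      ∑ i ∈ Finset.univ.erase i₀, (2 * (s.2 * s.1 i - meanPath lam i₀ η h₀ k i) ^ 2 +
        2 * meanPath lam i₀ η h₀ k i ^ 2) := by
    refine Finset.sum_le_sum fun i _ => ?_
    simp only [PiLp.smul_apply, smul_eq_mul]
    nlinarith [sq_nonneg (s.2 * s.1 i - 2 * meanPath lam i₀ η h₀ k i)]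
  rw [Finset.sum_add_distrib, ← Finset.mul_sum, ← Finset.mul_sum] at h4
  have h5 : (s.2 • s.1) i₀ = s.2 * s.1 i₀ := rfl
  rw [norm_sq_eq_add i₀, transDev, h5]
  have := abs_nonneg (normDev s)
  linarith

lemma noiseConst_bounds [Nonempty ι] {l₁ M : ℝ} (hM : 0 ≤ M) :
    39 * M + 2 * l₁ ^ 2 + 2 * (Fintype.card ι * (39 * M + 2 * l₁ ^ 2) + 37 * M) ≤
        noiseConst ι l₁ M ∧
      3 * (Fintype.card ι * (39 * M + 2 * l₁ ^ 2) + 37 * M) ≤ noiseConst ι l₁ M ∧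
      16 * M + (39 * M + 2 * l₁ ^ 2) + 3 * ((39 * M + 2 * l₁ ^ 2) + 37 * M) ≤
        noiseConst ι l₁ M ∧ 0 ≤ noiseConst ι l₁ M := by
  have h1 : (1 : ℝ) ≤ Fintype.card ι := by exact_mod_cast Fintype.card_pos
  have h2 : 0 ≤ 39 * M + 2 * l₁ ^ 2 := by positivity
  have h3 : 39 * M + 2 * l₁ ^ 2 ≤ Fintype.card ι * (39 * M + 2 * l₁ ^ 2) := by nlinarith
  unfold noiseConst
  refine ⟨?_, ?_, ?_, ?_⟩ <;> linarith

/-- Expected transversal deviation after one step. -/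
lemma lintegral_transPot_step_le (H : IsOjaNoise ν A n lam i₀ l₂ M) {η c δ : ℝ} (hη : 0 < η)
    (hη1 : η * lam i₀ ≤ 1) (hc : c ≤ 1 / 16) (hδ : 0 < δ) {h₀ : EuclideanSpace ℝ ι}
    (hh₀ : ‖h₀‖ = 1) (k : ℕ) (s : EuclideanSpace ℝ ι × ℝ) :
    ∫⁻ z, ENNReal.ofReal (transPot lam i₀ c η δ h₀ (k + 1) (scaledStep A n lam i₀ c η δ s z)) ∂ν ≤
      ENNReal.ofReal ((contr (lam i₀) l₂ η + noiseConst ι (lam i₀) M * η ^ 2) *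
        transPot lam i₀ c η δ h₀ k s +
        noiseConst ι (lam i₀) M * η ^ 2 * (δ ^ 2 + contr (lam i₀) l₂ η ^ k)) := by
  have : Nonempty ι := ⟨i₀⟩
  obtain ⟨hC1, hC2, -, hC0⟩ := noiseConst_bounds (ι := ι) (l₁ := lam i₀) H.M_nonneg
  have hρ := contr_nonneg (lam i₀) l₂ η
  have hρk := pow_nonneg hρ k
  by_cases hs : leadDev i₀ δ s ≤ c * δ ^ 2
  swap
  · have h0 : ∀ z, transPot lam i₀ c η δ h₀ (k + 1) (scaledStep A n lam i₀ c η δ s z) = 0 := by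
      intro z
      rw [transPot, if_neg]
      simp only [scaledStep, hs, false_and, if_false]
      exact not_leadDev_le_of_eq_zero hc hδ _
    simp [h0]
  obtain ⟨-, -, hh2, he⟩ := alive_bounds hc hδ hs
  have hY := norm_sq_le_of_alive H hη hη1 hc hδ hh₀ k hs
  have hr : 0 < 1 + η * lam i₀ := by have := H.l₁_pos; positivity
  have hr1 : 1 ≤ (1 + η * lam i₀) ^ 2 := by nlinarith [H.l₁_pos, mul_pos hη H.l₁_pos]
  choose G hGi hGint hG0 hG using fun i => H.exists_majorant hη hη1 (s.2 • s.1) i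
    ((1 + η * lam i) * (s.2 * s.1 i - meanPath lam i₀ η h₀ k i))
  have hn2 := H.integrable_sq
  refine lintegral_ofReal_le (G := fun z => (∑ i ∈ Finset.univ.erase i₀, G i z + (|normDev s| +
    37 * η ^ 2 * n z ^ 2 * ‖s.2 • s.1‖ ^ 2)) / (1 + η * lam i₀) ^ 2) ?_ ?_ ?_ ?_
  · exact ((integrable_finsetSum _ fun i _ => hGi i).add (by fun_prop)).div_const _
  · intro z
    have := Finset.sum_nonneg fun i (_ : i ∈ Finset.univ.erase i₀) => hG0 i z
    positivity
  · intro z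
    by_cases hz : η * n z ≤ 1 / 4
    swap
    · rw [transPot, if_neg]
      · have := Finset.sum_nonneg fun i (_ : i ∈ Finset.univ.erase i₀) => hG0 i z
        positivity
      · simp only [scaledStep, hz, and_false, if_false]
        exact not_leadDev_le_of_eq_zero hc hδ _
    refine (transPot_le ..).trans ?_
    simp only [scaledStep, hs, hz, and_self, if_true, transDev]
    rw [normDev_div, add_div, Finset.sum_div]
    refine add_le_add (Finset.sum_le_sum fun i _ => ?_) ?_
    · rw [le_div_iff₀ (by positivity), ← mul_pow]
      refine le_of_eq_of_le ?_ (hG i z _ (abs_inner_le (H.norm_le z) (H.n_nonneg z) hh2) hz)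
      have h1 : meanPath lam i₀ η h₀ (k + 1) i * (1 + η * lam i₀) =
          (1 + η * lam i) * meanPath lam i₀ η h₀ k i := by
        simp only [meanPath, pow_succ]; field_simp
      have h2 := scaled_apply_step (A z) η (lam i) s.1 s.2 i
      rw [sub_mul, h1, div_mul_eq_mul_div, div_mul_cancel₀ _ hr.ne', h2]
      ring
    · gcongr
      exact abs_normDev_step_le (H.norm_le z) (H.n_nonneg z) hη hz hh2 he
  · rw [integral_div, integral_add (integrable_finsetSum _ fun i _ => hGi i) (by fun_prop),
      integral_finsetSum _ fun i _ => hGi i]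
    simp only [mul_right_comm _ (n _ ^ 2)]
    rw [integral_add (by fun_prop) (by fun_prop), integral_const_mul, integral_const,
      probReal_univ, one_smul, div_le_iff₀ (by positivity)]
    simp only [transPot, hs, if_true]
    set F : ι → ℝ := fun i => s.2 * s.1 i - meanPath lam i₀ η h₀ k i with hF
    set Y := ‖s.2 • s.1‖ ^ 2
    set r := (1 + η * lam i₀) ^ 2
    set c₀ := 39 * M + 2 * lam i₀ ^ 2
    have hM := H.M_nonneg
    have hc₀ : 0 ≤ c₀ := by positivity
    have hY0 : 0 ≤ Y := sq_nonneg _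
    have hrr : contr (lam i₀) l₂ η * r = (1 + η * l₂) ^ 2 := by
      rw [contr, div_pow, div_mul_cancel₀ _ (by positivity)]
    have hl : 1 ≤ (1 + η * l₂) ^ 2 := by nlinarith [mul_pos hη H.l₂_pos]
    have hlr : (1 + η * l₂) ^ 2 ≤ r := by
      have := H.l₂_lt; have := H.l₂_pos
      change (1 + η * l₂) ^ 2 ≤ (1 + η * lam i₀) ^ 2
      gcongr
    have h1 : ∀ i ∈ Finset.univ.erase i₀, ∫ z, G i z ∂ν ≤
        ((1 + η * l₂) ^ 2 + c₀ * η ^ 2 * r) * F i ^ 2 + c₀ * η ^ 2 * (r * Y) := by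
      intro i hi
      have h2 : ((1 + η * lam i) * F i) ^ 2 ≤ (1 + η * l₂) ^ 2 * F i ^ 2 := by
        rw [mul_pow]
        have h3 : 0 ≤ 1 + η * lam i := by nlinarith [H.neg_le i]
        have h4 := H.lam_le i (Finset.ne_of_mem_erase hi)
        gcongr
      calc _ ≤ _ := hGint i
        _ ≤ (1 + η * l₂) ^ 2 * F i ^ 2 + c₀ * η ^ 2 * (r * F i ^ 2 + r * Y) := by
          have : (1 + η * l₂) ^ 2 * F i ^ 2 ≤ r * F i ^ 2 := by gcongr
          have : Y ≤ r * Y := le_mul_of_one_le_left hY0 hr1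
          have : ((1 + η * lam i) * F i) ^ 2 + Y ≤ r * F i ^ 2 + r * Y := by linarith
          gcongr
        _ = _ := by ring
    have h2 := Finset.sum_le_sum h1
    rw [Finset.sum_add_distrib, ← Finset.mul_sum, Finset.sum_const, nsmul_eq_mul] at h2
    have hcard : ((Finset.univ.erase i₀).card : ℝ) ≤ Fintype.card ι := by
      exact_mod_cast Finset.card_le_univ _
    have h3 : ((Finset.univ.erase i₀).card : ℝ) * (c₀ * η ^ 2 * (r * Y)) ≤
        Fintype.card ι * (c₀ * η ^ 2 * (r * Y)) := by gcongr
    have h4 : 37 * η ^ 2 * Y * ∫ z, n z ^ 2 ∂ν ≤ 37 * η ^ 2 * (r * Y) * M := by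
      have := H.integral_sq_le
      have : Y ≤ r * Y := le_mul_of_one_le_left hY0 hr1
      gcongr
    have h5 : |normDev s| ≤ ((1 + η * l₂) ^ 2 + c₀ * η ^ 2 * r) * |normDev s| :=
      le_mul_of_one_le_left (abs_nonneg _) (hl.trans (le_add_of_nonneg_right (by positivity)))
    have hU : transDev lam i₀ η h₀ k s =
      ∑ i ∈ Finset.univ.erase i₀, F i ^ 2 + |normDev s| := rfl
    set U := transDev lam i₀ η h₀ k s
    have hU0 : 0 ≤ U := transDev_nonneg ..
    set C := noiseConst ι (lam i₀) M
    set ρ := contr (lam i₀) l₂ η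
    set S := ∑ i ∈ Finset.univ.erase i₀, F i ^ 2
    have h6 : ((1 + η * l₂) ^ 2 + c₀ * η ^ 2 * r) * U +
        (Fintype.card ι * c₀ + 37 * M) * (η ^ 2 * r) * Y ≤
        (ρ * U + C * η ^ 2 * U + C * η ^ 2 * (δ ^ 2 + ρ ^ k)) * r := by
      rw [← hrr]
      have hηr : 0 ≤ η ^ 2 * r := by positivity
      have hK : 0 ≤ Fintype.card ι * c₀ + 37 * M := by positivity
      have h7 : (Fintype.card ι * c₀ + 37 * M) * Y ≤ (C - c₀) * U + C * (δ ^ 2 + ρ ^ k) := by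
        calc _ ≤ (Fintype.card ι * c₀ + 37 * M) * (3 * δ ^ 2 + 2 * U + 2 * ρ ^ k) := by gcongr
          _ = 2 * (Fintype.card ι * c₀ + 37 * M) * U +
              3 * (Fintype.card ι * c₀ + 37 * M) * (δ ^ 2 + ρ ^ k) -
              (Fintype.card ι * c₀ + 37 * M) * ρ ^ k := by ring
          _ ≤ 2 * (Fintype.card ι * c₀ + 37 * M) * U +
              3 * (Fintype.card ι * c₀ + 37 * M) * (δ ^ 2 + ρ ^ k) :=
            sub_le_self _ (by positivity)
          _ ≤ _ := by gcongr; linarith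
      calc _ = ρ * r * U + c₀ * (η ^ 2 * r) * U +
            ((Fintype.card ι * c₀ + 37 * M) * Y) * (η ^ 2 * r) := by ring
        _ ≤ ρ * r * U + c₀ * (η ^ 2 * r) * U +
            ((C - c₀) * U + C * (δ ^ 2 + ρ ^ k)) * (η ^ 2 * r) := by gcongr
        _ = _ := by ring
    rw [hU] at h6
    rw [hU]
    linarith

/-- Expected leading deviation after one step. -/
lemma lintegral_leadPot_step_le (H : IsOjaNoise ν A n lam i₀ l₂ M) {η c δ : ℝ} (hη : 0 < η)
    (hη1 : η * lam i₀ ≤ 1) (hc0 : 0 < c) (hc : c ≤ 1 / 16) (hδ : 0 < δ)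
    {h₀ : EuclideanSpace ℝ ι} (hh₀ : ‖h₀‖ = 1) (k : ℕ) (s : EuclideanSpace ℝ ι × ℝ) :
    ∫⁻ z, ENNReal.ofReal (leadPot i₀ c δ (scaledStep A n lam i₀ c η δ s z)) ∂ν ≤
      ENNReal.ofReal (leadPot i₀ c δ s + noiseConst ι (lam i₀) M / c * (η ^ 2 / δ ^ 2) *
        transPot lam i₀ c η δ h₀ k s +
        noiseConst ι (lam i₀) M / c * (η ^ 2 * (1 + contr (lam i₀) l₂ η ^ k / δ ^ 2))) := by
  have : Nonempty ι := ⟨i₀⟩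
  obtain ⟨-, -, hC1, hC0⟩ := noiseConst_bounds (ι := ι) (l₁ := lam i₀) H.M_nonneg
  have hρ := contr_nonneg (lam i₀) l₂ η
  have hρk := pow_nonneg hρ k
  by_cases hs : leadDev i₀ δ s ≤ c * δ ^ 2
  swap
  · have h1 : leadPot i₀ c δ s = 1 := if_neg hs
    have h2 := transPot_nonneg lam i₀ c η δ h₀ k s
    -- Above the threshold the potential already has its maximal value, so nothing is left to
    -- estimate.
    calc _ ≤ ∫⁻ z, 1 ∂ν := lintegral_mono fun z => by
          rw [ENNReal.ofReal_le_one]; exact leadPot_le_one hc0 hδ _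
      _ = ENNReal.ofReal 1 := by simp
      _ ≤ _ := by
        apply ENNReal.ofReal_le_ofReal
        rw [h1, add_assoc]
        exact le_add_of_nonneg_right (by positivity)
  obtain ⟨-, -, hh2, he⟩ := alive_bounds hc hδ hs
  have hY := norm_sq_le_of_alive H hη hη1 hc hδ hh₀ k hs
  have hr : 0 < 1 + η * lam i₀ := by have := H.l₁_pos; positivity
  have hr1 : 1 ≤ (1 + η * lam i₀) ^ 2 := by nlinarith [H.l₁_pos, mul_pos hη H.l₁_pos]
  obtain ⟨G, hGi, hGint, hG0, hG⟩ := H.exists_majorant hη hη1 (s.2 • s.1) i₀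
    ((1 + η * lam i₀) * (s.2 * s.1 i₀ - δ))
  have hn2 := H.integrable_sq
  -- The summand 16 η² n² exceeds 1 when η n > 1/4 and thereby pays for killing the chain.
  refine lintegral_ofReal_le (G := fun z => 16 * η ^ 2 * n z ^ 2 + (G z + (|normDev s| +
    37 * η ^ 2 * ‖s.2 • s.1‖ ^ 2 * n z ^ 2)) / ((1 + η * lam i₀) ^ 2 * (c * δ ^ 2))) ?_ ?_ ?_ ?_
  · fun_prop
  · intro z
    have := hG0 z
    positivity
  · intro z
    by_cases hz : η * n z ≤ 1 / 4
    swap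
    · have := hG0 z
      refine (leadPot_le_one hc0 hδ _).trans (le_add_of_le_of_nonneg ?_ (by positivity))
      push Not at hz
      have : (1 / 4) ^ 2 ≤ (η * n z) ^ 2 := by gcongr
      linarith [mul_pow η (n z) 2]
    refine (leadPot_le hc0 hδ _).trans (le_add_of_nonneg_of_le (by positivity) ?_)
    rw [← div_div _ ((1 + η * lam i₀) ^ 2)]
    have hcδ : 0 ≤ c * δ ^ 2 := by positivity
    refine div_le_div_of_nonneg_right ?_ hcδ
    simp only [scaledStep, hs, hz, and_self, if_true]
    simp only [leadDev]
    rw [normDev_div, add_div]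
    refine add_le_add ?_ ?_
    · rw [le_div_iff₀ (by positivity), ← mul_pow]
      refine le_of_eq_of_le ?_ (hG z _ (abs_inner_le (H.norm_le z) (H.n_nonneg z) hh2) hz)
      have h2 := scaled_apply_step (A z) η (lam i₀) s.1 s.2 i₀
      rw [sub_mul, div_mul_eq_mul_div, div_mul_cancel₀ _ hr.ne', h2]
      ring
    · gcongr
      exact (abs_normDev_step_le (H.norm_le z) (H.n_nonneg z) hη hz hh2 he).trans_eq (by ring)
  · rw [integral_add (by fun_prop) (by fun_prop), integral_div, integral_add hGi (by fun_prop),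
      integral_add (by fun_prop) (by fun_prop), integral_const_mul, integral_const_mul,
      integral_const, probReal_univ, one_smul]
    simp only [transPot, leadPot, hs, if_true]
    set D := s.2 * s.1 i₀ - δ with hD
    set Y := ‖s.2 • s.1‖ ^ 2
    set r := (1 + η * lam i₀) ^ 2
    set c₀ := 39 * M + 2 * lam i₀ ^ 2
    set U := transDev lam i₀ η h₀ k s
    set C := noiseConst ι (lam i₀) M
    set ρ := contr (lam i₀) l₂ η
    have hM := H.M_nonneg
    have hI := H.integral_sq_le
    have hI0 : 0 ≤ ∫ z, n z ^ 2 ∂ν := integral_nonneg fun z => sq_nonneg _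
    have hc₀ : 0 ≤ c₀ := by positivity
    have hY0 : 0 ≤ Y := sq_nonneg _
    have hU0 : 0 ≤ U := transDev_nonneg ..
    have hL : leadDev i₀ δ s = D ^ 2 + |normDev s| := rfl
    have hcδ : 0 < c * δ ^ 2 := by positivity
    have hDδ : D ^ 2 ≤ δ ^ 2 := by
      have : c * δ ^ 2 ≤ δ ^ 2 := mul_le_of_le_one_left (sq_nonneg _) (by linarith)
      linarith [abs_nonneg (normDev s)]
    have h1 : ∫ z, G z ∂ν + (|normDev s| + 37 * η ^ 2 * Y * ∫ z, n z ^ 2 ∂ν) ≤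
        r * (D ^ 2 + |normDev s| + η ^ 2 * (c₀ * δ ^ 2 + (c₀ + 37 * M) * Y)) := by
      have e1 : ((1 + η * lam i₀) * D) ^ 2 = r * D ^ 2 := by rw [mul_pow]
      rw [e1] at hGint
      have e2 : Y ≤ r * Y := le_mul_of_one_le_left hY0 hr1
      have e3 : |normDev s| ≤ r * |normDev s| := le_mul_of_one_le_left (abs_nonneg _) hr1
      have e4 : 37 * η ^ 2 * Y * ∫ z, n z ^ 2 ∂ν ≤ 37 * η ^ 2 * (r * Y) * M := by gcongr
      have e5 : c₀ * η ^ 2 * (r * D ^ 2 + Y) ≤ c₀ * η ^ 2 * (r * δ ^ 2 + r * Y) := by gcongr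
      linarith
    have h2 : (∫ z, G z ∂ν + (|normDev s| + 37 * η ^ 2 * Y * ∫ z, n z ^ 2 ∂ν)) / (r * (c * δ ^ 2)) ≤
        (D ^ 2 + |normDev s| + η ^ 2 * (c₀ * δ ^ 2 + (c₀ + 37 * M) * Y)) / (c * δ ^ 2) := by
      rw [← div_div]
      gcongr
      rw [div_le_iff₀ (by positivity)]
      linarith
    have h3 : 16 * η ^ 2 * ∫ z, n z ^ 2 ∂ν ≤ (η ^ 2 * (16 * M * δ ^ 2)) / (c * δ ^ 2) := by
      rw [le_div_iff₀ hcδ]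
      calc _ ≤ 16 * η ^ 2 * M * (1 * δ ^ 2) := by gcongr; linarith
        _ = _ := by ring
    have h4 : c₀ * δ ^ 2 + (c₀ + 37 * M) * Y + 16 * M * δ ^ 2 ≤ C * (U + (δ ^ 2 + ρ ^ k)) := by
      calc _ ≤ c₀ * δ ^ 2 + (c₀ + 37 * M) * (3 * δ ^ 2 + 2 * U + 2 * ρ ^ k) + 16 * M * δ ^ 2 := by
            gcongr
        _ ≤ (16 * M + c₀ + 3 * (c₀ + 37 * M)) * (U + (δ ^ 2 + ρ ^ k)) := by
          have : 0 ≤ (16 * M + c₀ + (c₀ + 37 * M)) * (U + ρ ^ k) := by positivity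
          linarith
        _ ≤ _ := by gcongr
    have h5 : C / c * (η ^ 2 / δ ^ 2) * U + C / c * (η ^ 2 * (1 + ρ ^ k / δ ^ 2)) =
        η ^ 2 * (C * (U + (δ ^ 2 + ρ ^ k))) / (c * δ ^ 2) := by
      field_simp
    rw [add_assoc, h5, hL]
    calc _ ≤ (η ^ 2 * (16 * M * δ ^ 2)) / (c * δ ^ 2) +
          (D ^ 2 + |normDev s| + η ^ 2 * (c₀ * δ ^ 2 + (c₀ + 37 * M) * Y)) / (c * δ ^ 2) :=
        add_le_add h3 h2
      _ = (D ^ 2 + |normDev s|) / (c * δ ^ 2) +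
          η ^ 2 * (c₀ * δ ^ 2 + (c₀ + 37 * M) * Y + 16 * M * δ ^ 2) / (c * δ ^ 2) := by
        field_simp; ring
      _ ≤ _ := by gcongr

end Drift

/-! ### The rescaled chain and its moments along the iteration. -/

section Chain

set_option linter.unusedSectionVars false

variable {ι : Type*} [Fintype ι] [DecidableEq ι] {Z : Type*} [MeasurableSpace Z]
  {ν : Measure Z} [IsProbabilityMeasure ν]
  {A : Z → EuclideanSpace ℝ ι →ₗ[ℝ] EuclideanSpace ℝ ι} {n : Z → ℝ} {lam : ι → ℝ} {i₀ : ι}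
  {l₂ M : ℝ}

/-- The iterates of Oja's rule. -/
def ojaIter (A : Z → EuclideanSpace ℝ ι →ₗ[ℝ] EuclideanSpace ℝ ι) (η : ℝ)
    (h₀ : EuclideanSpace ℝ ι) (z : ℕ → Z) : ℕ → EuclideanSpace ℝ ι
  | 0 => h₀
  | k + 1 => ojaStep η (A (z k)) (ojaIter A η h₀ z k)

/-- The iterates of `scaledStep`, with initial scale `1`. -/
def scaledIter (A : Z → EuclideanSpace ℝ ι →ₗ[ℝ] EuclideanSpace ℝ ι) (n : Z → ℝ) (lam : ι → ℝ)
    (i₀ : ι) (c η δ : ℝ) (h₀ : EuclideanSpace ℝ ι) (z : ℕ → Z) : ℕ → EuclideanSpace ℝ ι × ℝ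
  | 0 => (h₀, 1)
  | k + 1 => scaledStep A n lam i₀ c η δ (scaledIter A n lam i₀ c η δ h₀ z k) (z k)

lemma scaledIter_fst (c η δ : ℝ) (h₀ : EuclideanSpace ℝ ι) (z : ℕ → Z) (k : ℕ) :
    (scaledIter A n lam i₀ c η δ h₀ z k).1 = ojaIter A η h₀ z k := by
  induction k with
  | zero => rfl
  | succ k ih => simp only [scaledIter, scaledStep, ojaIter, ih]

lemma measurable_normDev : Measurable (normDev : EuclideanSpace ℝ ι × ℝ → ℝ) := by
  unfold normDev; fun_prop

lemma measurable_leadDev (i₀ : ι) (δ : ℝ) : Measurable (leadDev i₀ δ) := by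
  have : Measurable (normDev : EuclideanSpace ℝ ι × ℝ → ℝ) := measurable_normDev
  unfold leadDev; fun_prop

lemma measurable_transDev (lam : ι → ℝ) (i₀ : ι) (η : ℝ) (h₀ : EuclideanSpace ℝ ι) (k : ℕ) :
    Measurable (transDev lam i₀ η h₀ k) := by
  have : Measurable (normDev : EuclideanSpace ℝ ι × ℝ → ℝ) := measurable_normDev
  unfold transDev; fun_prop

lemma measurable_leadPot (i₀ : ι) (c δ : ℝ) : Measurable (leadPot i₀ c δ) :=
  Measurable.ite (measurableSet_le (measurable_leadDev i₀ δ) measurable_const)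
    ((measurable_leadDev i₀ δ).div_const _) measurable_const

lemma measurable_transPot (lam : ι → ℝ) (i₀ : ι) (c η δ : ℝ) (h₀ : EuclideanSpace ℝ ι) (k : ℕ) :
    Measurable (transPot lam i₀ c η δ h₀ k) :=
  Measurable.ite (measurableSet_le (measurable_leadDev i₀ δ) measurable_const)
    (measurable_transDev lam i₀ η h₀ k) measurable_const

lemma measurable_scaledStep (H : IsOjaNoise ν A n lam i₀ l₂ M) (c η δ : ℝ) :
    Measurable fun p : (EuclideanSpace ℝ ι × ℝ) × Z => scaledStep A n lam i₀ c η δ p.1 p.2 := by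
  have hA : Measurable fun p : (EuclideanSpace ℝ ι × ℝ) × Z => A p.2 p.1.1 :=
    H.measurable_A.comp (by fun_prop : Measurable fun p : (EuclideanSpace ℝ ι × ℝ) × Z =>
      (p.1.1, p.2))
  have hn := H.measurable_n
  have hi : Measurable fun p : (EuclideanSpace ℝ ι × ℝ) × Z =>
      (inner ℝ p.1.1 (A p.2 p.1.1) : ℝ) := Measurable.inner (by fun_prop) hA
  have h1 : Measurable fun p : (EuclideanSpace ℝ ι × ℝ) × Z => p.1.1 := by fun_prop
  have h2 : Measurable fun p : (EuclideanSpace ℝ ι × ℝ) × Z => p.1.2 := by fun_prop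
  refine Measurable.prodMk (h1.add ((hA.sub (hi.smul h1)).const_smul η))
    (Measurable.ite ?_ ((h2.mul ((hi.const_mul η).const_add 1)).div_const _) measurable_const)
  exact (measurableSet_le ((measurable_leadDev i₀ δ).comp measurable_fst) measurable_const).inter
    (measurableSet_le ((hn.comp measurable_snd).const_mul η) measurable_const)

variable {Ω : Type*} [mΩ : MeasurableSpace Ω] {Pr : Measure Ω} [IsProbabilityMeasure Pr]
  {z : ℕ → Ω → Z}

/-- The state at time k depends only on the samples before k; this is what makes it independent of
`z k`. -/
lemma measurable_scaledIter_iSup (H : IsOjaNoise ν A n lam i₀ l₂ M) (c η δ : ℝ)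
    (h₀ : EuclideanSpace ℝ ι) (k : ℕ) :
    Measurable[⨆ j ∈ Set.Iio k, MeasurableSpace.comap (z j) inferInstance]
      fun ω => scaledIter A n lam i₀ c η δ h₀ (fun j => z j ω) k := by
  induction k with
  | zero => exact measurable_const
  | succ k ih =>
    have h1 : Measurable[⨆ j ∈ Set.Iio (k + 1), MeasurableSpace.comap (z j) inferInstance]
        fun ω => scaledIter A n lam i₀ c η δ h₀ (fun j => z j ω) k :=
      ih.mono (biSup_mono fun j hj => Set.mem_Iio.2 (by have := Set.mem_Iio.1 hj; omega)) le_rfl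
    have h2 : Measurable[⨆ j ∈ Set.Iio (k + 1), MeasurableSpace.comap (z j) inferInstance] (z k) :=
      (comap_measurable (z k)).mono
        (le_iSup₂_of_le k (Set.mem_Iio.2 (Nat.lt_succ_self k)) le_rfl) le_rfl
    exact (measurable_scaledStep H c η δ).comp (h1.prodMk h2)

lemma measurable_scaledIter (H : IsOjaNoise ν A n lam i₀ l₂ M) (c η δ : ℝ)
    (h₀ : EuclideanSpace ℝ ι) (hz : ∀ k, Measurable (z k)) (k : ℕ) :
    Measurable fun ω => scaledIter A n lam i₀ c η δ h₀ (fun j => z j ω) k :=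
  (measurable_scaledIter_iSup H c η δ h₀ k).mono
    (iSup₂_le fun j _ => (hz j).comap_le) le_rfl

/-- The Markov property, from independence of state and next sample and Tonelli's theorem. -/
lemma lintegral_scaledIter_succ (H : IsOjaNoise ν A n lam i₀ l₂ M) (c η δ : ℝ)
    (h₀ : EuclideanSpace ℝ ι) (hz : ∀ k, Measurable (z k)) (hlaw : ∀ k, Pr.map (z k) = ν)
    (hind : iIndepFun z Pr) (k : ℕ) {F : EuclideanSpace ℝ ι × ℝ → ENNReal} (hF : Measurable F) :
    ∫⁻ ω, F (scaledIter A n lam i₀ c η δ h₀ (fun j => z j ω) (k + 1)) ∂Pr =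
      ∫⁻ ω, ∫⁻ x, F (scaledStep A n lam i₀ c η δ
        (scaledIter A n lam i₀ c η δ h₀ (fun j => z j ω) k) x) ∂ν ∂Pr := by
  have hm := measurable_scaledIter H c η δ h₀ hz k
  have h1 : IndepFun (fun ω => scaledIter A n lam i₀ c η δ h₀ (fun j => z j ω) k) (z k) Pr := by
    have h2 := indep_iSup_of_disjoint (S := Set.Iio k) (T := {k}) (fun j => (hz j).comap_le) hind
      (by simp)
    rw [iSup_singleton] at h2
    exact indep_of_indep_of_le_left h2 (measurable_scaledIter_iSup H c η δ h₀ k).comap_le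
  have h2 := (indepFun_iff_map_prod_eq_prod_map_map hm.aemeasurable (hz k).aemeasurable).1 h1
  rw [hlaw] at h2
  have hs : Measurable fun p : (EuclideanSpace ℝ ι × ℝ) × Z =>
      F (scaledStep A n lam i₀ c η δ p.1 p.2) := hF.comp (measurable_scaledStep H c η δ)
  calc _ = ∫⁻ ω, (fun p : (EuclideanSpace ℝ ι × ℝ) × Z =>
        F (scaledStep A n lam i₀ c η δ p.1 p.2))
        (scaledIter A n lam i₀ c η δ h₀ (fun j => z j ω) k, z k ω) ∂Pr := rfl
    _ = _ := by
      rw [← lintegral_map hs (hm.prodMk (hz k)), h2, lintegral_prod _ hs.aemeasurable,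
        lintegral_map hs.lintegral_prod_right' hm]

lemma lintegral_ofReal_mul_le {f : Ω → ℝ} (hf : Measurable f) {a x : ℝ} (ha : 0 ≤ a)
    (h : ∫⁻ ω, ENNReal.ofReal (f ω) ∂Pr ≤ ENNReal.ofReal x) :
    ∫⁻ ω, ENNReal.ofReal (a * f ω) ∂Pr ≤ ENNReal.ofReal (a * x) := by
  simp_rw [ENNReal.ofReal_mul ha]
  rw [lintegral_const_mul _ hf.ennreal_ofReal]
  gcongr

/-- Any supersolution `m` of the drift recursion is a bound, since the deviation vanishes at time 0:
the mean path starts at `h₀`, and ‖h₀‖ = 1. -/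
lemma lintegral_transPot_le (H : IsOjaNoise ν A n lam i₀ l₂ M) {η c δ : ℝ} (hη : 0 < η)
    (hη1 : η * lam i₀ ≤ 1) (hc : c ≤ 1 / 16) (hδ : 0 < δ) {h₀ : EuclideanSpace ℝ ι}
    (hh₀ : ‖h₀‖ = 1) (hz : ∀ k, Measurable (z k))
    (hlaw : ∀ k, Pr.map (z k) = ν) (hind : iIndepFun z Pr) {m : ℕ → ℝ} (hm0 : ∀ k, 0 ≤ m k)
    (hm : ∀ k, (contr (lam i₀) l₂ η + noiseConst ι (lam i₀) M * η ^ 2) * m k +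
      noiseConst ι (lam i₀) M * η ^ 2 * (δ ^ 2 + contr (lam i₀) l₂ η ^ k) ≤ m (k + 1)) (k : ℕ) :
    ∫⁻ ω, ENNReal.ofReal (transPot lam i₀ c η δ h₀ k
      (scaledIter A n lam i₀ c η δ h₀ (fun j => z j ω) k)) ∂Pr ≤ ENNReal.ofReal (m k) := by
  have : Nonempty ι := ⟨i₀⟩
  have hC0 := (noiseConst_bounds (ι := ι) (l₁ := lam i₀) H.M_nonneg).2.2.2
  have hρ := contr_nonneg (lam i₀) l₂ η
  induction k with
  | zero =>
    have h1 : transPot lam i₀ c η δ h₀ 0 (h₀, 1) ≤ 0 := by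
      refine (transPot_le ..).trans_eq ?_
      simp [transDev, meanPath, normDev, hh₀]
    simp [scaledIter, ENNReal.ofReal_of_nonpos h1]
  | succ k ih =>
    have hρk := pow_nonneg hρ k
    have hmeas := (measurable_transPot lam i₀ c η δ h₀ k).comp
      (measurable_scaledIter H c η δ h₀ hz k)
    rw [lintegral_scaledIter_succ H c η δ h₀ hz hlaw hind k
      (measurable_transPot lam i₀ c η δ h₀ (k + 1)).ennreal_ofReal]
    calc _ ≤ ∫⁻ ω, (ENNReal.ofReal ((contr (lam i₀) l₂ η + noiseConst ι (lam i₀) M * η ^ 2) *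
          transPot lam i₀ c η δ h₀ k (scaledIter A n lam i₀ c η δ h₀ (fun j => z j ω) k)) +
          ENNReal.ofReal (noiseConst ι (lam i₀) M * η ^ 2 *
            (δ ^ 2 + contr (lam i₀) l₂ η ^ k))) ∂Pr :=
        lintegral_mono fun ω => (lintegral_transPot_step_le H hη hη1 hc hδ hh₀ k _).trans
          ENNReal.ofReal_add_le
      _ ≤ ENNReal.ofReal ((contr (lam i₀) l₂ η + noiseConst ι (lam i₀) M * η ^ 2) * m k) +
          ENNReal.ofReal (noiseConst ι (lam i₀) M * η ^ 2 *
            (δ ^ 2 + contr (lam i₀) l₂ η ^ k)) := by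
        rw [lintegral_add_right _ measurable_const, lintegral_const, measure_univ, mul_one]
        gcongr
        exact lintegral_ofReal_mul_le hmeas (by positivity) ih
      _ ≤ _ := by
        have := hm0 k
        rw [← ENNReal.ofReal_add (by positivity) (by positivity)]
        exact ENNReal.ofReal_le_ofReal (hm k)

lemma lintegral_leadPot_le (H : IsOjaNoise ν A n lam i₀ l₂ M) {η c δ : ℝ} (hη : 0 < η)
    (hη1 : η * lam i₀ ≤ 1) (hc0 : 0 < c) (hc : c ≤ 1 / 16) (hδ : 0 < δ)
    {h₀ : EuclideanSpace ℝ ι} (hh₀ : ‖h₀‖ = 1) (hh₀δ : h₀ i₀ = δ)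
    (hz : ∀ k, Measurable (z k)) (hlaw : ∀ k, Pr.map (z k) = ν) (hind : iIndepFun z Pr)
    {m p : ℕ → ℝ} (hm0 : ∀ k, 0 ≤ m k)
    (hm : ∀ k, (contr (lam i₀) l₂ η + noiseConst ι (lam i₀) M * η ^ 2) * m k +
      noiseConst ι (lam i₀) M * η ^ 2 * (δ ^ 2 + contr (lam i₀) l₂ η ^ k) ≤ m (k + 1))
    (hp0 : ∀ k, 0 ≤ p k)
    (hp : ∀ k, p k + noiseConst ι (lam i₀) M / c * (η ^ 2 / δ ^ 2) * m k +
      noiseConst ι (lam i₀) M / c * (η ^ 2 * (1 + contr (lam i₀) l₂ η ^ k / δ ^ 2)) ≤ p (k + 1))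
    (k : ℕ) :
    ∫⁻ ω, ENNReal.ofReal (leadPot i₀ c δ
      (scaledIter A n lam i₀ c η δ h₀ (fun j => z j ω) k)) ∂Pr ≤ ENNReal.ofReal (p k) := by
  have : Nonempty ι := ⟨i₀⟩
  have hC0 := (noiseConst_bounds (ι := ι) (l₁ := lam i₀) H.M_nonneg).2.2.2
  have hρ := contr_nonneg (lam i₀) l₂ η
  induction k with
  | zero =>
    have h1 : leadPot i₀ c δ (h₀, 1) ≤ 0 := by
      refine (leadPot_le hc0 hδ _).trans_eq ?_
      simp [leadDev, normDev, hh₀, hh₀δ]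
    simp [scaledIter, ENNReal.ofReal_of_nonpos h1]
  | succ k ih =>
    have hρk := pow_nonneg hρ k
    have hmeas := (measurable_transPot lam i₀ c η δ h₀ k).comp
      (measurable_scaledIter H c η δ h₀ hz k)
    have hmeas' : Measurable fun ω => leadPot i₀ c δ
        (scaledIter A n lam i₀ c η δ h₀ (fun j => z j ω) k) :=
      (measurable_leadPot i₀ c δ).comp (measurable_scaledIter H c η δ h₀ hz k)
    have hT := lintegral_transPot_le H hη hη1 hc hδ hh₀ hz hlaw hind hm0 hm k
    rw [lintegral_scaledIter_succ H c η δ h₀ hz hlaw hind k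
      (measurable_leadPot i₀ c δ).ennreal_ofReal]
    calc _ ≤ ∫⁻ ω, (ENNReal.ofReal (leadPot i₀ c δ
            (scaledIter A n lam i₀ c η δ h₀ (fun j => z j ω) k)) +
          ENNReal.ofReal (noiseConst ι (lam i₀) M / c * (η ^ 2 / δ ^ 2) *
          transPot lam i₀ c η δ h₀ k (scaledIter A n lam i₀ c η δ h₀ (fun j => z j ω) k)) +
          ENNReal.ofReal (noiseConst ι (lam i₀) M / c *
            (η ^ 2 * (1 + contr (lam i₀) l₂ η ^ k / δ ^ 2)))) ∂Pr :=
        lintegral_mono fun ω => (lintegral_leadPot_step_le H hη hη1 hc0 hc hδ hh₀ k _).trans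
          (ENNReal.ofReal_add_le.trans (add_le_add_left ENNReal.ofReal_add_le _))
      _ ≤ ENNReal.ofReal (p k) +
          ENNReal.ofReal (noiseConst ι (lam i₀) M / c * (η ^ 2 / δ ^ 2) * m k) +
          ENNReal.ofReal (noiseConst ι (lam i₀) M / c *
            (η ^ 2 * (1 + contr (lam i₀) l₂ η ^ k / δ ^ 2))) := by
        rw [lintegral_add_right _ measurable_const, lintegral_const, measure_univ, mul_one,
          lintegral_add_left hmeas'.ennreal_ofReal]
        gcongr
        exact lintegral_ofReal_mul_le hmeas (by positivity) hT
      _ ≤ _ := by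
        have := hm0 k
        have := hp0 k
        rw [← ENNReal.ofReal_add (by positivity) (by positivity),
          ← ENNReal.ofReal_add (by positivity) (by positivity)]
        exact ENNReal.ofReal_le_ofReal (hp k)

end Chain

/-! ### From small deviations to passing the level 1 - δ². -/

section Escape

set_option linter.unusedSectionVars false

variable {ι : Type*} [Fintype ι] [DecidableEq ι] {Z : Type*} [MeasurableSpace Z]
  {ν : Measure Z} [IsProbabilityMeasure ν]
  {A : Z → EuclideanSpace ℝ ι →ₗ[ℝ] EuclideanSpace ℝ ι} {n : Z → ℝ} {lam : ι → ℝ} {i₀ : ι}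
  {l₂ M : ℝ}

/-- With a = g h_{i₀}, Q the transversal mass and g² = a² + Q + e, the claim becomes (1 - δ²)(Q + e)
≤ δ² a². The slack 4 t of the mean path absorbs the factor 1 + t in the comparison of Q with the
mean path, the fluctuation term, and the loss in a² ≥ (1 - t) δ². -/
lemma one_sub_sq_le_of_dev (H : IsOjaNoise ν A n lam i₀ l₂ M) {η δ t : ℝ} (hη : 0 < η)
    (hη1 : η * lam i₀ ≤ 1) (ht : 0 < t) (ht1 : t ≤ 1 / 2) (hδ : 0 < δ) (hδ1 : δ < 1)
    {h₀ : EuclideanSpace ℝ ι} (hh₀ : ‖h₀‖ = 1) (hh₀δ : h₀ i₀ = δ) {N : ℕ}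
    (hN : (1 - δ ^ 2) ^ 2 * contr (lam i₀) l₂ η ^ N ≤ (1 - 4 * t) * δ ^ 4)
    {s : EuclideanSpace ℝ ι × ℝ} (hs : leadDev i₀ δ s ≤ t ^ 2 / 4 * δ ^ 2)
    (hU : transDev lam i₀ η h₀ N s ≤ t ^ 2 / 2 * δ ^ 4) :
    1 - δ ^ 2 ≤ s.1 i₀ ^ 2 := by
  have hq := sum_sq_meanPath_le H hη hη1 h₀ N
  rw [hh₀, hh₀δ, one_pow] at hq
  have hδ2 : 0 < 1 - δ ^ 2 := by nlinarith
  set a := s.2 * s.1 i₀ with ha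
  set Q := ∑ i ∈ Finset.univ.erase i₀, (s.2 * s.1 i) ^ 2 with hQ
  set P := ∑ i ∈ Finset.univ.erase i₀, meanPath lam i₀ η h₀ N i ^ 2 with hP
  set F := ∑ i ∈ Finset.univ.erase i₀, (s.2 * s.1 i - meanPath lam i₀ η h₀ N i) ^ 2 with hF
  have hU' : F + |normDev s| ≤ t ^ 2 / 2 * δ ^ 4 := hU
  have hF0 : 0 ≤ F := Finset.sum_nonneg fun i _ => sq_nonneg _
  have hQP : Q ≤ (1 + t) * P + (1 + 1 / t) * F := by
    rw [hQ, hP, hF, Finset.mul_sum, Finset.mul_sum, ← Finset.sum_add_distrib]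
    refine Finset.sum_le_sum fun i _ => ?_
    set x := s.2 * s.1 i
    set y := meanPath lam i₀ η h₀ N i
    -- Young's inequality with weight t, its defect written as a square.
    have : (1 + t) * y ^ 2 + (1 + 1 / t) * (x - y) ^ 2 - x ^ 2 = (t * y - (x - y)) ^ 2 / t := by
      field_simp; ring
    have h2 : 0 ≤ (t * y - (x - y)) ^ 2 / t := by positivity
    linarith
  have hQe : (1 - δ ^ 2) * (Q + |normDev s|) ≤ (1 - t) * δ ^ 4 := by
    have h1 : (1 - δ ^ 2) * P ≤ (1 - 4 * t) * δ ^ 4 := by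
      calc _ ≤ (1 - δ ^ 2) * (contr (lam i₀) l₂ η ^ N * (1 - δ ^ 2)) := by gcongr
        _ = (1 - δ ^ 2) ^ 2 * contr (lam i₀) l₂ η ^ N := by ring
        _ ≤ _ := hN
    have h2 : Q + |normDev s| ≤ (1 + t) * P + (1 + 1 / t) * (t ^ 2 / 2 * δ ^ 4) := by
      have h3 : (1 + 1 / t) * (F + |normDev s|) ≤ (1 + 1 / t) * (t ^ 2 / 2 * δ ^ 4) := by gcongr
      have h4 : 0 ≤ 1 / t * |normDev s| := by positivity
      linarith
    have h5 : (1 + 1 / t) * (t ^ 2 / 2 * δ ^ 4) = (t ^ 2 + t) / 2 * δ ^ 4 := by field_simp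
    rw [h5] at h2
    have h6 : (1 - δ ^ 2) * ((t ^ 2 + t) / 2 * δ ^ 4) ≤ (t ^ 2 + t) / 2 * δ ^ 4 :=
      mul_le_of_le_one_left (by positivity) (by linarith [sq_nonneg δ])
    calc _ ≤ (1 - δ ^ 2) * ((1 + t) * P + (t ^ 2 + t) / 2 * δ ^ 4) := by gcongr
      _ = (1 + t) * ((1 - δ ^ 2) * P) + (1 - δ ^ 2) * ((t ^ 2 + t) / 2 * δ ^ 4) := by ring
      _ ≤ (1 + t) * ((1 - 4 * t) * δ ^ 4) + (t ^ 2 + t) / 2 * δ ^ 4 := by gcongr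
      _ = (1 - 5 / 2 * t - 7 / 2 * t ^ 2) * δ ^ 4 := by ring
      _ ≤ _ := mul_le_mul_of_nonneg_right (by nlinarith) (by positivity)
  have haδ : (1 - t) * δ ^ 2 ≤ a ^ 2 := by
    have h1 : (a - δ) ^ 2 ≤ (t / 2 * δ) ^ 2 := by
      have h2 : (a - δ) ^ 2 + |normDev s| ≤ t ^ 2 / 4 * δ ^ 2 := hs
      linarith [abs_nonneg (normDev s), mul_pow (t / 2) δ 2]
    have h2 := (abs_le_of_sq_le_sq' h1 (by positivity)).1
    have h3 : ((1 - t / 2) * δ) ^ 2 ≤ a ^ 2 :=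
      pow_le_pow_left₀ (mul_nonneg (by linarith) hδ.le) (by linarith) 2
    nlinarith [mul_nonneg (sq_nonneg t) (sq_nonneg δ)]
  have hg : s.2 ^ 2 = normDev s + (a ^ 2 + Q) := by
    have h1 := normDev_add_norm_sq s
    rw [norm_sq_eq_add i₀] at h1
    exact h1.symm
  have hmain : (1 - δ ^ 2) * s.2 ^ 2 ≤ s.2 ^ 2 * s.1 i₀ ^ 2 := by
    rw [← mul_pow, ← ha, hg]
    have h1 : (1 - t) * δ ^ 4 ≤ δ ^ 2 * a ^ 2 := by nlinarith [sq_nonneg δ]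
    have h2 : (1 - δ ^ 2) * normDev s ≤ (1 - δ ^ 2) * |normDev s| := by
      gcongr; exact le_abs_self _
    linarith
  have hg0 : 0 < s.2 ^ 2 := by
    have : s.2 ≠ 0 := by
      rintro h
      rw [ha, h] at haδ
      have : 0 < (1 - t) * δ ^ 2 := mul_pos (by linarith) (by positivity)
      linarith
    positivity
  exact le_of_mul_le_mul_left (by linarith) hg0

/-- The upper bound makes geometric sums of ρ ^ k of order 1 / (η (λ₁ - l₂)). The lower bound allows
an index shift, or a factor ρ, at the price of 4. -/
lemma contr_bounds (H : IsOjaNoise ν A n lam i₀ l₂ M) {η : ℝ} (hη : 0 < η)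
    (hη1 : η * lam i₀ ≤ 1) :
    1 / 4 ≤ contr (lam i₀) l₂ η ∧ contr (lam i₀) l₂ η ≤ 1 - η * (lam i₀ - l₂) / 2 := by
  have h1 := H.l₁_pos
  have h2 := H.l₂_pos
  have h3 := H.l₂_lt
  have h4 : 0 < 1 + η * lam i₀ := by positivity
  have h5 : 1 / 2 ≤ (1 + η * l₂) / (1 + η * lam i₀) := by
    rw [le_div_iff₀ h4]; nlinarith
  have h6 : (1 + η * l₂) / (1 + η * lam i₀) ≤ 1 - η * (lam i₀ - l₂) / 2 := by
    rw [div_le_iff₀ h4]; nlinarith [mul_pos hη (sub_pos.2 h3)]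
  have h7 : 0 ≤ η * (lam i₀ - l₂) := mul_nonneg hη.le (sub_pos.2 h3).le
  rw [contr]
  constructor <;> nlinarith

variable {Ω : Type*} [mΩ : MeasurableSpace Ω] {Pr : Measure Ω} [IsProbabilityMeasure Pr]
  {z : ℕ → Ω → Z}

set_option maxHeartbeats 1000000 in
/-- Oja's rule, started at `h i₀ = δ`, has passed `h i₀ ^ 2 = 1 - δ ^ 2` with probability `3 / 4`
once the mean path has, if `η / δ ^ 2` is small. -/
theorem three_fourths_le_ojaIter (H : IsOjaNoise ν A n lam i₀ l₂ M) {t K : ℝ} (ht : 0 < t)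
    (ht1 : t ≤ 1 / 2) (hK : 0 ≤ K) (hz : ∀ k, Measurable (z k)) (hlaw : ∀ k, Pr.map (z k) = ν)
    (hind : iIndepFun z Pr) :
    ∃ R : ℝ, 0 < R ∧ ∀ η δ : ℝ, 0 < η → 0 < δ → δ ^ 2 ≤ 1 / 2 → η / δ ^ 2 * R ≤ 1 →
      ∀ h₀ : EuclideanSpace ℝ ι, ‖h₀‖ = 1 → h₀ i₀ = δ → ∀ N : ℕ, N * η ≤ K / δ ^ 2 →
      (1 - δ ^ 2) ^ 2 * contr (lam i₀) l₂ η ^ N ≤ (1 - 4 * t) * δ ^ 4 →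
      3 / 4 ≤ Pr.real {ω | 1 - δ ^ 2 ≤ ojaIter A η h₀ (fun j => z j ω) N i₀ ^ 2} := by
  have hne : Nonempty ι := ⟨i₀⟩
  have hC0 := (noiseConst_bounds (ι := ι) (l₁ := lam i₀) H.M_nonneg).2.2.2
  set C := noiseConst ι (lam i₀) M with hC
  have hgap : 0 < lam i₀ - l₂ := sub_pos.2 H.l₂_lt
  set γ := lam i₀ - l₂ with hγ
  have hl₁ := H.l₁_pos
  have hc0 : 0 < t ^ 2 / 4 := by positivity
  have hc : t ^ 2 / 4 ≤ 1 / 16 := by nlinarith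
  set c := t ^ 2 / 4 with hc_def
  -- Each summand is one smallness condition on ε = η / δ², extracted below as `r1` to `r6`; the
  -- last two bound the failure probabilities by 1/8.
  refine ⟨1 + lam i₀ + 4 * C / γ + 4 * C * K + 8 * (C / c * (K * (1 + 8 * C / γ) + 4 / γ)) +
    8 * (C / (t ^ 2 / 2) * (4 / γ + 48 * K)), by positivity, ?_⟩
  intro η δ hη hδ hδ2 hR h₀ hh₀ hh₀δ N hNη hN
  have hδ1 : δ < 1 := by nlinarith
  set ε := η / δ ^ 2 with hε
  have hε0 : 0 < ε := by positivity
  have hηε : η = ε * δ ^ 2 := by rw [hε]; field_simp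
  have hηle : η ≤ ε := by rw [hηε]; nlinarith
  have hpiece : ∀ x y : ℝ, 0 ≤ y → x + y = 1 + lam i₀ + 4 * C / γ + 4 * C * K +
      8 * (C / c * (K * (1 + 8 * C / γ) + 4 / γ)) + 8 * (C / (t ^ 2 / 2) * (4 / γ + 48 * K)) →
      ε * x ≤ 1 := by
    intro x y hy hxy
    rw [← hxy] at hR
    linarith [mul_nonneg hε0.le hy]
  have r1 : ε ≤ 1 := by
    have := hpiece 1 (lam i₀ + 4 * C / γ + 4 * C * K +
      8 * (C / c * (K * (1 + 8 * C / γ) + 4 / γ)) + 8 * (C / (t ^ 2 / 2) * (4 / γ + 48 * K)))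
      (by positivity) (by ring)
    linarith
  have r2 : ε * lam i₀ ≤ 1 := hpiece (lam i₀) (1 + 4 * C / γ + 4 * C * K +
      8 * (C / c * (K * (1 + 8 * C / γ) + 4 / γ)) + 8 * (C / (t ^ 2 / 2) * (4 / γ + 48 * K)))
      (by positivity) (by ring)
  have r3 : ε * (4 * C / γ) ≤ 1 := hpiece _ (1 + lam i₀ + 4 * C * K +
      8 * (C / c * (K * (1 + 8 * C / γ) + 4 / γ)) + 8 * (C / (t ^ 2 / 2) * (4 / γ + 48 * K)))
      (by positivity) (by ring)
  have r4 : ε * (4 * C * K) ≤ 1 := hpiece _ (1 + lam i₀ + 4 * C / γ +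
      8 * (C / c * (K * (1 + 8 * C / γ) + 4 / γ)) + 8 * (C / (t ^ 2 / 2) * (4 / γ + 48 * K)))
      (by positivity) (by ring)
  have r5 : ε * (8 * (C / c * (K * (1 + 8 * C / γ) + 4 / γ))) ≤ 1 :=
    hpiece _ (1 + lam i₀ + 4 * C / γ + 4 * C * K +
      8 * (C / (t ^ 2 / 2) * (4 / γ + 48 * K))) (by positivity) (by ring)
  have r6 : ε * (8 * (C / (t ^ 2 / 2) * (4 / γ + 48 * K))) ≤ 1 :=
    hpiece _ (1 + lam i₀ + 4 * C / γ + 4 * C * K +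
      8 * (C / c * (K * (1 + 8 * C / γ) + 4 / γ))) (by positivity) (by ring)
  clear hpiece hR
  have hη1 : η * lam i₀ ≤ 1 := (mul_le_mul_of_nonneg_right hηle hl₁.le).trans r2
  obtain ⟨hρ4, hρ1⟩ := contr_bounds H hη hη1
  rw [← hγ] at hρ1
  have hρ0 : 0 ≤ contr (lam i₀) l₂ η := contr_nonneg _ _ _
  have hNη2 : N * η ^ 2 ≤ K * ε := by
    calc N * η ^ 2 = (N * η) * η := by ring
      _ ≤ K / δ ^ 2 * η := by gcongr
      _ = _ := by rw [hε]; ring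
  -- `B` dominates 1 / (1 - σ), where σ below is ρ with the noise correction C η².
  set B := 4 / (γ * η) with hB
  have hB0 : 0 < B := by positivity
  have hBη : η * B = 4 / γ := by rw [hB]; field_simp
  have hηγ : 0 < η * γ := by positivity
  have hCη : C * η ^ 2 ≤ η * γ / 4 := by
    have h1 : η * (4 * C / γ) ≤ 1 := (mul_le_mul_of_nonneg_right hηle (by positivity)).trans r3
    have h2 : η * (4 * C / γ) = 4 * (C * η) / γ := by ring
    rw [h2, div_le_one hgap] at h1
    linarith [mul_le_mul_of_nonneg_left h1 hη.le]
  set ρ := contr (lam i₀) l₂ η with hρ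
  set σ := ρ + C * η ^ 2 with hσ
  have hCη0 : 0 ≤ C * η ^ 2 := by positivity
  have hρσ : ρ ≤ σ := le_add_of_nonneg_right hCη0
  have hσ0 : 0 ≤ σ := hρ0.trans hρσ
  have hσ1 : 1 ≤ (1 - σ) * B := by
    have h1 : η * γ / 4 ≤ 1 - σ := by linarith
    calc 1 = η * γ / 4 * B := by rw [hB]; field_simp
      _ ≤ _ := by gcongr
  have hρB : 1 ≤ (1 - ρ) * B := hσ1.trans (by gcongr)
  have hρle : ρ ≤ 1 := by linarith
  have hρk1 : ∀ k, ρ ^ k ≤ 1 := fun k => pow_le_one₀ hρ0 hρle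
  have hρk0 : ∀ k, 0 ≤ ρ ^ k := fun k => pow_nonneg hρ0 k
  -- The part δ² B answers the constant forcing δ². The part 4 k σ ^ k answers the nearly resonant
  -- forcing ρ ^ k, with the 4 from ρ ^ k ≤ 4 σ ^ (k + 1).
  have hT := lintegral_transPot_le (m := fun k => C * η ^ 2 * (δ ^ 2 * B + 4 * k * σ ^ k))
    H hη hη1 hc hδ hh₀ hz hlaw hind (fun k => by positivity) (fun k => by
      have h1 : σ * (δ ^ 2 * B + 4 * k * σ ^ k) + (δ ^ 2 + ρ ^ k) ≤
          δ ^ 2 * B + 4 * ((k : ℝ) + 1) * σ ^ (k + 1) := by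
        have h2 : ρ ^ k ≤ 4 * σ ^ (k + 1) := by
          calc ρ ^ k ≤ σ ^ k := by gcongr
            _ ≤ 4 * (σ ^ k * σ) := by
              linarith [mul_le_mul_of_nonneg_left (hρ4.trans hρσ) (pow_nonneg hσ0 k)]
            _ = _ := by rw [pow_succ]
        have h3 : δ ^ 2 * 1 ≤ δ ^ 2 * ((1 - σ) * B) := by gcongr
        rw [pow_succ σ k] at h2 ⊢
        linarith
      push_cast
      rw [← hC, ← hρ, ← hσ]
      linarith [mul_le_mul_of_nonneg_left h1 hCη0]) N
  -- For the leading coordinate a bound on the transversal potential uniform in time is enough. The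
  -- term B (1 - ρ ^ k) telescopes and dominates the sum of the ρ ^ j.
  have hL := lintegral_leadPot_le (m := fun _ => C * η ^ 2 * (2 * B))
    (p := fun k => C / c * (k * (η ^ 2 * (1 + 2 * (C * η ^ 2 * B) / δ ^ 2)) +
      η ^ 2 / δ ^ 2 * (B * (1 - ρ ^ k))))
    H hη hη1 hc0 hc hδ hh₀ hh₀δ hz hlaw hind (fun k => by positivity) (fun k => by
      rw [← hC, ← hρ, ← hσ]
      have h1 : σ * (2 * B) + (δ ^ 2 + ρ ^ k) ≤ 2 * B := by linarith [hρk1 k]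
      linarith [mul_le_mul_of_nonneg_left h1 hCη0])
    (fun k => by
      have := sub_nonneg.2 (hρk1 k)
      positivity)
    (fun k => by
      rw [← hC, ← hρ]
      have h1 : ρ ^ k ≤ B * (ρ ^ k - ρ ^ (k + 1)) := by
        rw [pow_succ]
        linarith [mul_le_mul_of_nonneg_left hρB (hρk0 k)]
      have h2 : η ^ 2 / δ ^ 2 * ρ ^ k ≤ η ^ 2 / δ ^ 2 * (B * (ρ ^ k - ρ ^ (k + 1))) := by gcongr
      have h3 : C / c * (k * (η ^ 2 * (1 + 2 * (C * η ^ 2 * B) / δ ^ 2)) +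
          η ^ 2 / δ ^ 2 * (B * (1 - ρ ^ k))) + C / c * (η ^ 2 / δ ^ 2) * (C * η ^ 2 * (2 * B)) +
          C / c * (η ^ 2 * (1 + ρ ^ k / δ ^ 2)) =
          C / c * ((k + 1) * (η ^ 2 * (1 + 2 * (C * η ^ 2 * B) / δ ^ 2)) +
            η ^ 2 / δ ^ 2 * (B * (1 - ρ ^ k)) + η ^ 2 / δ ^ 2 * ρ ^ k) := by ring
      push_cast
      rw [h3]
      refine mul_le_mul_of_nonneg_left ?_ (by positivity)
      linarith) N
  have hp8 : C / c * (N * (η ^ 2 * (1 + 2 * (C * η ^ 2 * B) / δ ^ 2)) +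
      η ^ 2 / δ ^ 2 * (B * (1 - ρ ^ N))) ≤ 1 / 8 := by
    have h1 : 2 * (C * η ^ 2 * B) / δ ^ 2 = 8 * C / γ * ε := by
      calc _ = 2 * C * (η * B) * (η / δ ^ 2) := by ring
        _ = _ := by rw [hBη, ← hε]; ring
    have h2 : η ^ 2 / δ ^ 2 * (B * (1 - ρ ^ N)) ≤ 4 / γ * ε := by
      calc _ = (η * B) * (η / δ ^ 2) * (1 - ρ ^ N) := by ring
        _ = 4 / γ * ε * (1 - ρ ^ N) := by rw [hBη, ← hε]
        _ ≤ _ := mul_le_of_le_one_right (by positivity) (by linarith [hρk0 N])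
    have h3 : 8 * C / γ * ε ≤ 8 * C / γ := mul_le_of_le_one_right (by positivity) r1
    have h4 : N * (η ^ 2 * (1 + 8 * C / γ * ε)) ≤ K * ε * (1 + 8 * C / γ) := by
      calc _ = N * η ^ 2 * (1 + 8 * C / γ * ε) := by ring
        _ ≤ _ := by gcongr
    rw [h1]
    calc _ ≤ C / c * (K * ε * (1 + 8 * C / γ) + 4 / γ * ε) := by gcongr
      _ ≤ _ := by linarith
  -- The correction C η² in σ accumulates over N steps to a factor at most e ≤ 3, and ρ ^ N ≤ 4 δ⁴
  -- because 1 - δ² ≥ 1/2.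
  have hσN : σ ^ N ≤ 12 * δ ^ 4 := by
    have h1 : σ ≤ ρ * (1 + 4 * (C * η ^ 2)) := by
      linarith [mul_le_mul_of_nonneg_right hρ4 hCη0]
    have h2 : (1 + 4 * (C * η ^ 2)) ^ N ≤ 3 := by
      calc _ ≤ Real.exp (4 * (C * η ^ 2)) ^ N := by
            gcongr; linarith [Real.add_one_le_exp (4 * (C * η ^ 2))]
        _ = Real.exp (N * (4 * (C * η ^ 2))) := (Real.exp_nat_mul _ _).symm
        _ ≤ Real.exp 1 := by
          gcongr
          calc _ = 4 * C * (N * η ^ 2) := by ring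
            _ ≤ 4 * C * (K * ε) := by gcongr
            _ ≤ 1 := by linarith
        _ ≤ 3 := by linarith [Real.exp_one_lt_d9]
    have h3 : ρ ^ N ≤ 4 * δ ^ 4 := by
      have h4 : (1 / 2) ^ 2 * ρ ^ N ≤ (1 - δ ^ 2) ^ 2 * ρ ^ N := by gcongr; linarith
      have h5 : (1 - 4 * t) * δ ^ 4 ≤ δ ^ 4 := mul_le_of_le_one_left (by positivity) (by linarith)
      linarith
    calc σ ^ N ≤ (ρ * (1 + 4 * (C * η ^ 2))) ^ N := by gcongr
      _ = ρ ^ N * (1 + 4 * (C * η ^ 2)) ^ N := mul_pow _ _ _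
      _ ≤ 4 * δ ^ 4 * 3 := by gcongr
      _ = _ := by ring
  have hm8 : C * η ^ 2 * (δ ^ 2 * B + 4 * N * σ ^ N) ≤ t ^ 2 / 2 * δ ^ 4 * (1 / 8) := by
    have h1 : η ^ 2 * (δ ^ 2 * B) = 4 / γ * ε * δ ^ 4 := by
      calc _ = (η * B) * (η * δ ^ 2) := by ring
        _ = _ := by rw [hBη, hηε]; ring
    have h2 : η ^ 2 * (4 * N * σ ^ N) ≤ 48 * K * ε * δ ^ 4 := by
      calc _ = 4 * (N * η ^ 2) * σ ^ N := by ring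
        _ ≤ 4 * (K * ε) * (12 * δ ^ 4) := by gcongr
        _ = _ := by ring
    calc _ = C * (η ^ 2 * (δ ^ 2 * B) + η ^ 2 * (4 * N * σ ^ N)) := by ring
      _ ≤ C * (4 / γ * ε * δ ^ 4 + 48 * K * ε * δ ^ 4) := by rw [h1]; gcongr
      _ = ε * (8 * (C / (t ^ 2 / 2) * (4 / γ + 48 * K))) * (t ^ 2 / 2 * δ ^ 4 * (1 / 8)) := by
        field_simp
      _ ≤ 1 * (t ^ 2 / 2 * δ ^ 4 * (1 / 8)) := by gcongr
      _ = _ := one_mul _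
  set S : Ω → EuclideanSpace ℝ ι × ℝ :=
    fun ω => scaledIter A n lam i₀ c η δ h₀ (fun j => z j ω) N with hS
  have hSm : Measurable S := measurable_scaledIter H c η δ h₀ hz N
  set bad₁ : Set Ω := {ω | (1 : ENNReal) ≤ ENNReal.ofReal (leadPot i₀ c δ (S ω))}
  set bad₂ : Set Ω := {ω | ENNReal.ofReal (t ^ 2 / 2 * δ ^ 4) ≤
    ENNReal.ofReal (transPot lam i₀ c η δ h₀ N (S ω))}
  have hb₁ : Pr bad₁ ≤ ENNReal.ofReal (1 / 8) := by
    have h1 := mul_meas_ge_le_lintegral (μ := Pr)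
      (((measurable_leadPot i₀ c δ).comp hSm).ennreal_ofReal) 1
    rw [one_mul] at h1
    exact h1.trans (hL.trans (ENNReal.ofReal_le_ofReal hp8))
  have hb₂ : Pr bad₂ ≤ ENNReal.ofReal (1 / 8) := by
    have h1 := mul_meas_ge_le_lintegral (μ := Pr)
      (((measurable_transPot lam i₀ c η δ h₀ N).comp hSm).ennreal_ofReal)
      (ENNReal.ofReal (t ^ 2 / 2 * δ ^ 4))
    have h2 := h1.trans (hT.trans (ENNReal.ofReal_le_ofReal hm8))
    have h3 : 0 < t ^ 2 / 2 * δ ^ 4 := by positivity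
    rw [ENNReal.ofReal_mul h3.le] at h2
    exact (ENNReal.mul_le_mul_iff_right (by simpa using h3) ENNReal.ofReal_ne_top).1 h2
  have hsub : Set.univ ⊆ {ω | 1 - δ ^ 2 ≤ ojaIter A η h₀ (fun j => z j ω) N i₀ ^ 2} ∪
      (bad₁ ∪ bad₂) := by
    intro ω _
    by_cases h1 : leadDev i₀ δ (S ω) ≤ c * δ ^ 2
    swap
    · right; left
      simp [bad₁, leadPot, h1]
    by_cases h2 : transDev lam i₀ η h₀ N (S ω) ≤ t ^ 2 / 2 * δ ^ 4
    swap
    · right; right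
      simp only [bad₂, Set.mem_ofPred_eq, transPot, h1, if_true]
      exact ENNReal.ofReal_le_ofReal (not_le.1 h2).le
    left
    have h3 := one_sub_sq_le_of_dev H hη hη1 ht ht1 hδ hδ1 hh₀ hh₀δ hN h1 h2
    rwa [hS, scaledIter_fst] at h3
  have h1 : (1 : ℝ) ≤ Pr.real {ω | 1 - δ ^ 2 ≤ ojaIter A η h₀ (fun j => z j ω) N i₀ ^ 2} +
      (Pr.real bad₁ + Pr.real bad₂) := by
    calc (1 : ℝ) = Pr.real Set.univ := probReal_univ.symm
      _ ≤ _ := measureReal_mono hsub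
      _ ≤ _ := measureReal_union_le _ _
      _ ≤ _ := by gcongr; exact measureReal_union_le _ _
  have h2 : Pr.real bad₁ ≤ 1 / 8 := ENNReal.toReal_le_of_le_ofReal (by norm_num) hb₁
  have h3 : Pr.real bad₂ ≤ 1 / 8 := ENNReal.toReal_le_of_le_ofReal (by norm_num) hb₂
  linarith

end Escape

/-! ### The Hebbian algorithm as Oja's rule in the coordinates `h`. -/

section Hebbian

variable {d : ℕ}

/-- The vector `Oᵀ x`. -/
def rot (O : Matrix (Fin d) (Fin d) ℝ) (x : Vec d) (i : Fin d) : ℝ := ∑ k, O k i * x k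

lemma sum_rot_mul_rot {O : Matrix (Fin d) (Fin d) ℝ} (hO : O ∈ Matrix.orthogonalGroup (Fin d) ℝ)
    (x y : Vec d) : ∑ i, rot O x i * rot O y i = inner ℝ x y := by
  have h1 : O * Oᵀ = 1 := (Matrix.mem_orthogonalGroup_iff (Fin d) ℝ).1 hO
  have h2 : ∀ x : Vec d, rot O x = Oᵀ *ᵥ x.ofLp := fun x => rfl
  have h3 : ∑ i, rot O x i * rot O y i = rot O x ⬝ᵥ rot O y := rfl
  rw [h3, h2, h2, Matrix.dotProduct_mulVec, Matrix.vecMul_transpose, Matrix.mulVec_mulVec, h1,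
    Matrix.one_mulVec, dotProduct_comm]
  simp [PiLp.inner_apply, dotProduct]

lemma sum_rot_sq {O : Matrix (Fin d) (Fin d) ℝ} (hO : O ∈ Matrix.orthogonalGroup (Fin d) ℝ)
    (x : Vec d) : ∑ i, rot O x i ^ 2 = ‖x‖ ^ 2 := by
  rw [← real_inner_self_eq_norm_sq, ← sum_rot_mul_rot hO]
  exact Finset.sum_congr rfl fun i _ => sq _

lemma rot_add_smul (O : Matrix (Fin d) (Fin d) ℝ) (x y w : Vec d) (η a b : ℝ) (i : Fin d) :
    rot O (x + η • (a • y - b • w)) i = rot O x i + η * (a * rot O y i - b * rot O w i) := by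
  simp only [rot, PiLp.add_apply, PiLp.smul_apply, PiLp.sub_apply, smul_eq_mul, Finset.mul_sum]
  rw [← Finset.sum_sub_distrib, Finset.mul_sum, ← Finset.sum_add_distrib]
  exact Finset.sum_congr rfl fun k _ => by ring

/-- The coordinates `hCoord` as a Euclidean vector. -/
def hVec (OX OY : Matrix (Fin d) (Fin d) ℝ) (p : Vec d × Vec d) :
    EuclideanSpace ℝ (Fin d ⊕ Fin d) :=
  WithLp.toLp 2 (hCoord OX OY p)

lemma hVec_inl (OX OY : Matrix (Fin d) (Fin d) ℝ) (p : Vec d × Vec d) (i : Fin d) :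
    hVec OX OY p (Sum.inl i) = (rot OX p.1 i + rot OY p.2 i) / 2 := by
  have h2 : (√2)⁻¹ * (√2)⁻¹ = (1 / 2 : ℝ) := by
    rw [← mul_inv, Real.mul_self_sqrt (by norm_num)]; norm_num
  simp only [hVec, hCoord, rotP, stack, Matrix.mulVec, dotProduct, Matrix.transpose_apply,
    Matrix.smul_apply, Fintype.sum_sum_type, Matrix.fromBlocks_apply₁₁, Matrix.fromBlocks_apply₂₁,
    Pi.smul_apply, Sum.elim_inl, Sum.elim_inr, smul_eq_mul, one_div, rot]
  rw [← Finset.sum_add_distrib, ← Finset.sum_add_distrib, Finset.sum_div]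
  refine Finset.sum_congr rfl fun k _ => ?_
  linear_combination (OX k i * p.1 k + OY k i * p.2 k) * h2

lemma hVec_inr (OX OY : Matrix (Fin d) (Fin d) ℝ) (p : Vec d × Vec d) (i : Fin d) :
    hVec OX OY p (Sum.inr i) = (rot OX p.1 i - rot OY p.2 i) / 2 := by
  have h2 : (√2)⁻¹ * (√2)⁻¹ = (1 / 2 : ℝ) := by
    rw [← mul_inv, Real.mul_self_sqrt (by norm_num)]; norm_num
  simp only [hVec, hCoord, rotP, stack, Matrix.mulVec, dotProduct, Matrix.transpose_apply,
    Matrix.smul_apply, Fintype.sum_sum_type, Matrix.fromBlocks_apply₁₂, Matrix.fromBlocks_apply₂₂,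
    Pi.smul_apply, Sum.elim_inl, Sum.elim_inr, smul_eq_mul, one_div, rot, Matrix.neg_apply]
  rw [← Finset.sum_add_distrib, ← Finset.sum_sub_distrib, Finset.sum_div]
  refine Finset.sum_congr rfl fun k _ => ?_
  linear_combination (OX k i * p.1 k - OY k i * p.2 k) * h2

/-- The first half of the vector with coordinates `h`. -/
def fstPart (h : EuclideanSpace ℝ (Fin d ⊕ Fin d)) (i : Fin d) : ℝ := h (Sum.inl i) + h (Sum.inr i)

/-- The second half of the vector with coordinates `h`. -/
def sndPart (h : EuclideanSpace ℝ (Fin d ⊕ Fin d)) (i : Fin d) : ℝ := h (Sum.inl i) - h (Sum.inr i)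

lemma fstPart_hVec (OX OY : Matrix (Fin d) (Fin d) ℝ) (p : Vec d × Vec d) (i : Fin d) :
    fstPart (hVec OX OY p) i = rot OX p.1 i := by
  rw [fstPart, hVec_inl, hVec_inr]; ring

lemma sndPart_hVec (OX OY : Matrix (Fin d) (Fin d) ℝ) (p : Vec d × Vec d) (i : Fin d) :
    sndPart (hVec OX OY p) i = rot OY p.2 i := by
  rw [sndPart, hVec_inl, hVec_inr]; ring

lemma two_mul_norm_sq (h : EuclideanSpace ℝ (Fin d ⊕ Fin d)) :
    2 * ‖h‖ ^ 2 = ∑ i, fstPart h i ^ 2 + ∑ i, sndPart h i ^ 2 := by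
  rw [EuclideanSpace.real_norm_sq_eq, Fintype.sum_sum_type, ← Finset.sum_add_distrib,
    ← Finset.sum_add_distrib, Finset.mul_sum]
  exact Finset.sum_congr rfl fun i _ => by simp only [fstPart, sndPart]; ring

lemma norm_hVec {OX OY : Matrix (Fin d) (Fin d) ℝ} (hOX : OX ∈ Matrix.orthogonalGroup (Fin d) ℝ)
    (hOY : OY ∈ Matrix.orthogonalGroup (Fin d) ℝ) {u v : Vec d} (hu : ‖u‖ = 1) (hv : ‖v‖ = 1) :
    ‖hVec OX OY (u, v)‖ = 1 := by
  have h1 := two_mul_norm_sq (hVec OX OY (u, v))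
  simp only [fstPart_hVec, sndPart_hVec] at h1
  rw [sum_rot_sq hOX, sum_rot_sq hOY, hu, hv] at h1
  have h2 : ‖hVec OX OY (u, v)‖ ^ 2 = 1 := by linarith
  exact (pow_eq_one_iff_of_nonneg (norm_nonneg _) two_ne_zero).1 h2

/-- The random operator `Pᵀ [[0, x yᵀ], [y xᵀ, 0]] P`. -/
def hebbOp (OX OY : Matrix (Fin d) (Fin d) ℝ) (z : Vec d × Vec d) :
    EuclideanSpace ℝ (Fin d ⊕ Fin d) →ₗ[ℝ] EuclideanSpace ℝ (Fin d ⊕ Fin d) where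
  toFun h := WithLp.toLp 2 (Sum.elim
    (fun i => ((∑ j, rot OY z.2 j * sndPart h j) * rot OX z.1 i +
      (∑ j, rot OX z.1 j * fstPart h j) * rot OY z.2 i) / 2)
    (fun i => ((∑ j, rot OY z.2 j * sndPart h j) * rot OX z.1 i -
      (∑ j, rot OX z.1 j * fstPart h j) * rot OY z.2 i) / 2))
  map_add' h h' := by
    have h1 : ∑ j, rot OY z.2 j * sndPart (h + h') j =
        ∑ j, rot OY z.2 j * sndPart h j + ∑ j, rot OY z.2 j * sndPart h' j := by
      rw [← Finset.sum_add_distrib]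
      exact Finset.sum_congr rfl fun j _ => by simp only [sndPart, PiLp.add_apply]; ring
    have h2 : ∑ j, rot OX z.1 j * fstPart (h + h') j =
        ∑ j, rot OX z.1 j * fstPart h j + ∑ j, rot OX z.1 j * fstPart h' j := by
      rw [← Finset.sum_add_distrib]
      exact Finset.sum_congr rfl fun j _ => by simp only [fstPart, PiLp.add_apply]; ring
    ext i
    rcases i with i | i <;> simp only [h1, h2, Sum.elim_inl, Sum.elim_inr, PiLp.add_apply] <;> ring
  map_smul' c h := by
    have h1 : ∑ j, rot OY z.2 j * sndPart (c • h) j = c * ∑ j, rot OY z.2 j * sndPart h j := by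
      rw [Finset.mul_sum]
      exact Finset.sum_congr rfl fun j _ => by
        simp only [sndPart, PiLp.smul_apply, smul_eq_mul]; ring
    have h2 : ∑ j, rot OX z.1 j * fstPart (c • h) j = c * ∑ j, rot OX z.1 j * fstPart h j := by
      rw [Finset.mul_sum]
      exact Finset.sum_congr rfl fun j _ => by
        simp only [fstPart, PiLp.smul_apply, smul_eq_mul]; ring
    ext i
    rcases i with i | i <;>
      simp only [h1, h2, Sum.elim_inl, Sum.elim_inr, PiLp.smul_apply, smul_eq_mul,
        RingHom.id_apply] <;> ring

lemma fstPart_hebbOp (OX OY : Matrix (Fin d) (Fin d) ℝ) (z : Vec d × Vec d)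
    (h : EuclideanSpace ℝ (Fin d ⊕ Fin d)) (i : Fin d) :
    fstPart (hebbOp OX OY z h) i = (∑ j, rot OY z.2 j * sndPart h j) * rot OX z.1 i := by
  simp only [hebbOp, fstPart, LinearMap.coe_mk, AddHom.coe_mk, Sum.elim_inl, Sum.elim_inr]
  ring

lemma sndPart_hebbOp (OX OY : Matrix (Fin d) (Fin d) ℝ) (z : Vec d × Vec d)
    (h : EuclideanSpace ℝ (Fin d ⊕ Fin d)) (i : Fin d) :
    sndPart (hebbOp OX OY z h) i = (∑ j, rot OX z.1 j * fstPart h j) * rot OY z.2 i := by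
  simp only [hebbOp, sndPart, LinearMap.coe_mk, AddHom.coe_mk, Sum.elim_inl, Sum.elim_inr]
  ring

lemma ext_parts {h h' : EuclideanSpace ℝ (Fin d ⊕ Fin d)} (h1 : ∀ i, fstPart h i = fstPart h' i)
    (h2 : ∀ i, sndPart h i = sndPart h' i) : h = h' := by
  ext i
  rcases i with i | i
  · have := h1 i; have := h2 i
    simp only [fstPart, sndPart] at *
    linarith
  · have := h1 i; have := h2 i
    simp only [fstPart, sndPart] at *
    linarith

lemma two_mul_inner (h h' : EuclideanSpace ℝ (Fin d ⊕ Fin d)) :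
    2 * (inner ℝ h h' : ℝ) =
      ∑ i, fstPart h i * fstPart h' i + ∑ i, sndPart h i * sndPart h' i := by
  rw [PiLp.inner_apply, Fintype.sum_sum_type, ← Finset.sum_add_distrib,
    ← Finset.sum_add_distrib, Finset.mul_sum]
  refine Finset.sum_congr rfl fun i _ => ?_
  simp only [fstPart, sndPart, RCLike.inner_apply, conj_trivial]; ring

/-- The sum and difference of the two halves of h are O_Xᵀ u and O_Yᵀ v. On them the operator
decouples into rank-one maps, and its quadratic form at h is uᵀ x yᵀ v, exactly the correction
factor of the algorithm. -/
lemma hVec_step {OX OY : Matrix (Fin d) (Fin d) ℝ} (hOX : OX ∈ Matrix.orthogonalGroup (Fin d) ℝ)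
    (hOY : OY ∈ Matrix.orthogonalGroup (Fin d) ℝ) (η : ℝ) (x y : Vec d) (p : Vec d × Vec d) :
    hVec OX OY (step η x y p) = ojaStep η (hebbOp OX OY (x, y)) (hVec OX OY p) := by
  have hα : ∑ j, rot OX x j * fstPart (hVec OX OY p) j = inner ℝ x p.1 := by
    simp only [fstPart_hVec, sum_rot_mul_rot hOX]
  have hβ : ∑ j, rot OY y j * sndPart (hVec OX OY p) j = inner ℝ y p.2 := by
    simp only [sndPart_hVec, sum_rot_mul_rot hOY]
  have hs : (inner ℝ (hVec OX OY p) (hebbOp OX OY (x, y) (hVec OX OY p)) : ℝ) =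
      inner ℝ x p.1 * inner ℝ y p.2 := by
    have h1 := two_mul_inner (hVec OX OY p) (hebbOp OX OY (x, y) (hVec OX OY p))
    simp only [fstPart_hebbOp, sndPart_hebbOp, fstPart_hVec, sndPart_hVec] at h1
    simp only [mul_left_comm (rot _ _ _), ← Finset.mul_sum, sum_rot_mul_rot hOX,
      sum_rot_mul_rot hOY] at h1
    rw [real_inner_comm x p.1, real_inner_comm y p.2] at h1
    linarith
  have hf : ∀ i, fstPart (ojaStep η (hebbOp OX OY (x, y)) (hVec OX OY p)) i =
      fstPart (hVec OX OY p) i + η * (fstPart (hebbOp OX OY (x, y) (hVec OX OY p)) i -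
        (inner ℝ x p.1 * inner ℝ y p.2) * fstPart (hVec OX OY p) i) := fun i => by
    simp only [ojaStep, hs, fstPart, PiLp.add_apply, PiLp.smul_apply, PiLp.sub_apply, smul_eq_mul]
    ring
  have hg : ∀ i, sndPart (ojaStep η (hebbOp OX OY (x, y)) (hVec OX OY p)) i =
      sndPart (hVec OX OY p) i + η * (sndPart (hebbOp OX OY (x, y) (hVec OX OY p)) i -
        (inner ℝ x p.1 * inner ℝ y p.2) * sndPart (hVec OX OY p) i) := fun i => by
    simp only [ojaStep, hs, sndPart, PiLp.add_apply, PiLp.smul_apply, PiLp.sub_apply, smul_eq_mul]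
    ring
  refine ext_parts (fun i => ?_) (fun i => ?_)
  · rw [hf, fstPart_hebbOp, fstPart_hVec, fstPart_hVec, hβ, step, rot_add_smul]
  · rw [hg, sndPart_hebbOp, sndPart_hVec, sndPart_hVec, hα, step, rot_add_smul]

lemma hVec_iter {OX OY : Matrix (Fin d) (Fin d) ℝ} (hOX : OX ∈ Matrix.orthogonalGroup (Fin d) ℝ)
    (hOY : OY ∈ Matrix.orthogonalGroup (Fin d) ℝ) (η : ℝ) (x y : ℕ → Vec d) (u₀ v₀ : Vec d)
    (k : ℕ) :
    hVec OX OY (iter η x y u₀ v₀ k) =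
      ojaIter (hebbOp OX OY) η (hVec OX OY (u₀, v₀)) (fun j => (x j, y j)) k := by
  induction k with
  | zero => rfl
  | succ k ih => rw [iter, hVec_step hOX hOY, ih, ojaIter]

/-- Cauchy–Schwarz in each half, where the operator has rank one. -/
lemma norm_hebbOp_le {OX OY : Matrix (Fin d) (Fin d) ℝ}
    (hOX : OX ∈ Matrix.orthogonalGroup (Fin d) ℝ) (hOY : OY ∈ Matrix.orthogonalGroup (Fin d) ℝ)
    (z : Vec d × Vec d) (h : EuclideanSpace ℝ (Fin d ⊕ Fin d)) :
    ‖hebbOp OX OY z h‖ ≤ ‖z.1‖ * ‖z.2‖ * ‖h‖ := by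
  have h1 := two_mul_norm_sq (hebbOp OX OY z h)
  simp only [fstPart_hebbOp, sndPart_hebbOp, mul_pow, ← Finset.mul_sum, sum_rot_sq hOX,
    sum_rot_sq hOY] at h1
  have h2 := Finset.sum_mul_sq_le_sq_mul_sq Finset.univ (rot OY z.2) (sndPart h)
  have h3 := Finset.sum_mul_sq_le_sq_mul_sq Finset.univ (rot OX z.1) (fstPart h)
  rw [sum_rot_sq hOY] at h2
  rw [sum_rot_sq hOX] at h3
  have h4 := two_mul_norm_sq h
  refine (sq_le_sq₀ (norm_nonneg _) (by positivity)).1 ?_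
  have h5 := mul_le_mul_of_nonneg_right h2 (sq_nonneg ‖z.1‖)
  have h6 := mul_le_mul_of_nonneg_right h3 (sq_nonneg ‖z.2‖)
  have h7 : (‖z.1‖ * ‖z.2‖ * ‖h‖) ^ 2 = ‖z.1‖ ^ 2 * ‖z.2‖ ^ 2 * (2 * ‖h‖ ^ 2) / 2 := by ring
  rw [h7, h4]
  linarith

lemma measurable_hebbOp (OX OY : Matrix (Fin d) (Fin d) ℝ) :
    Measurable fun p : EuclideanSpace ℝ (Fin d ⊕ Fin d) × (Vec d × Vec d) =>
      hebbOp OX OY p.2 p.1 := by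
  refine Continuous.measurable ?_
  simp only [hebbOp, LinearMap.coe_mk, AddHom.coe_mk]
  refine (PiLp.continuous_toLp 2 _).comp (continuous_pi fun i => ?_)
  rcases i with i | i <;> simp only [Sum.elim_inl, Sum.elim_inr, rot, fstPart, sndPart] <;> fun_prop

lemma integrable_norm_mul_norm_sq {D : Measure (Vec d × Vec d)} [IsProbabilityMeasure D]
    (hX4 : MemLp (fun z : Vec d × Vec d => z.1) 4 D)
    (hY4 : MemLp (fun z : Vec d × Vec d => z.2) 4 D) :
    Integrable (fun z => (‖z.1‖ * ‖z.2‖) ^ 2) D := by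
  have h1 := hX4.integrable_norm_pow (p := 4) (by norm_num)
  have h2 := hY4.integrable_norm_pow (p := 4) (by norm_num)
  refine (h1.add h2).mono' (by fun_prop) (.of_forall fun z => ?_)
  rw [Real.norm_of_nonneg (by positivity)]
  simp only [Pi.add_apply]
  nlinarith [sq_nonneg (‖z.1‖ ^ 2 - ‖z.2‖ ^ 2), sq_nonneg (‖z.1‖ ^ 2), sq_nonneg (‖z.2‖ ^ 2)]

lemma integrable_mul_apply {D : Measure (Vec d × Vec d)} [IsProbabilityMeasure D]
    (hD : Integrable (fun z : Vec d × Vec d => (‖z.1‖ * ‖z.2‖) ^ 2) D) (k l : Fin d) :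
    Integrable (fun z : Vec d × Vec d => z.1 k * z.2 l) D := by
  refine ((integrable_const 1).add hD).mono' (by fun_prop) (.of_forall fun z => ?_)
  rw [norm_mul]
  simp only [Pi.add_apply]
  calc ‖z.1 k‖ * ‖z.2 l‖ ≤ ‖z.1‖ * ‖z.2‖ := by
        gcongr <;> exact PiLp.norm_apply_le _ _
    _ ≤ _ := by nlinarith [sq_nonneg (‖z.1‖ * ‖z.2‖ - 1)]

lemma rot_mul_rot (OX OY : Matrix (Fin d) (Fin d) ℝ) (z : Vec d × Vec d) (i j : Fin d) :
    rot OX z.1 i * rot OY z.2 j = ∑ k, ∑ l, OX k i * OY l j * (z.1 k * z.2 l) := by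
  rw [rot, rot, Finset.sum_mul_sum]
  exact Finset.sum_congr rfl fun k _ => Finset.sum_congr rfl fun l _ => by ring

lemma integrable_rot_mul_rot {D : Measure (Vec d × Vec d)} [IsProbabilityMeasure D]
    (hD : Integrable (fun z : Vec d × Vec d => (‖z.1‖ * ‖z.2‖) ^ 2) D)
    (OX OY : Matrix (Fin d) (Fin d) ℝ) (i j : Fin d) :
    Integrable (fun z : Vec d × Vec d => rot OX z.1 i * rot OY z.2 j) D := by
  simp_rw [rot_mul_rot]
  exact integrable_finsetSum _ fun k _ => integrable_finsetSum _ fun l _ =>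
    (integrable_mul_apply hD k l).const_mul _

lemma integral_rot_mul_rot {D : Measure (Vec d × Vec d)} [IsProbabilityMeasure D]
    (hD : Integrable (fun z : Vec d × Vec d => (‖z.1‖ * ‖z.2‖) ^ 2) D)
    {OX OY : Matrix (Fin d) (Fin d) ℝ} (hOX : OX ∈ Matrix.orthogonalGroup (Fin d) ℝ)
    (hOY : OY ∈ Matrix.orthogonalGroup (Fin d) ℝ) {lam : Fin d → ℝ}
    (hSVD : crossMoment D = OX * Matrix.diagonal lam * OYᵀ) (i j : Fin d) :
    ∫ z, rot OX z.1 i * rot OY z.2 j ∂D = Matrix.diagonal lam i j := by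
  have h1 : OXᵀ * crossMoment D * OY = Matrix.diagonal lam := by
    have hX : OXᵀ * OX = 1 := (Matrix.mem_orthogonalGroup_iff' (Fin d) ℝ).1 hOX
    have hY : OYᵀ * OY = 1 := (Matrix.mem_orthogonalGroup_iff' (Fin d) ℝ).1 hOY
    rw [hSVD, Matrix.mul_assoc, Matrix.mul_assoc, hY, Matrix.mul_one, ← Matrix.mul_assoc, hX,
      Matrix.one_mul]
  rw [← h1]
  simp_rw [rot_mul_rot]
  rw [integral_finsetSum _ fun k _ => integrable_finsetSum _ fun l _ =>
    (integrable_mul_apply hD k l).const_mul _]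
  simp_rw [Matrix.mul_apply, Finset.sum_mul]
  rw [Finset.sum_comm]
  refine Finset.sum_congr rfl fun k _ => ?_
  rw [integral_finsetSum _ fun l _ => (integrable_mul_apply hD k l).const_mul _]
  refine Finset.sum_congr rfl fun l _ => ?_
  rw [integral_const_mul, crossMoment, Matrix.of_apply, Matrix.transpose_apply]
  ring

lemma integral_hebbOp {D : Measure (Vec d × Vec d)} [IsProbabilityMeasure D]
    (hD : Integrable (fun z : Vec d × Vec d => (‖z.1‖ * ‖z.2‖) ^ 2) D)
    {OX OY : Matrix (Fin d) (Fin d) ℝ} (hOX : OX ∈ Matrix.orthogonalGroup (Fin d) ℝ)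
    (hOY : OY ∈ Matrix.orthogonalGroup (Fin d) ℝ) {lam : Fin d → ℝ}
    (hSVD : crossMoment D = OX * Matrix.diagonal lam * OYᵀ)
    (h : EuclideanSpace ℝ (Fin d ⊕ Fin d)) (i : Fin d ⊕ Fin d) :
    ∫ z, hebbOp OX OY z h i ∂D = Sum.elim lam (fun j => -lam j) i * h i := by
  have hint := integrable_rot_mul_rot hD OX OY
  have hI := integral_rot_mul_rot hD hOX hOY hSVD
  have h1 : ∀ i, Integrable (fun z : Vec d × Vec d =>
      (∑ j, rot OY z.2 j * sndPart h j) * rot OX z.1 i) D ∧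
      ∫ z, (∑ j, rot OY z.2 j * sndPart h j) * rot OX z.1 i ∂D = lam i * sndPart h i := by
    intro i
    have e : ∀ z : Vec d × Vec d, (∑ j, rot OY z.2 j * sndPart h j) * rot OX z.1 i =
        ∑ j, sndPart h j * (rot OX z.1 i * rot OY z.2 j) := fun z => by
      rw [Finset.sum_mul]; exact Finset.sum_congr rfl fun j _ => by ring
    simp_rw [e]
    refine ⟨integrable_finsetSum _ fun j _ => (hint i j).const_mul _, ?_⟩
    rw [integral_finsetSum _ fun j _ => (hint i j).const_mul _]
    simp_rw [integral_const_mul, hI, Matrix.diagonal_apply]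
    simp [mul_comm]
  have h2 : ∀ i, Integrable (fun z : Vec d × Vec d =>
      (∑ j, rot OX z.1 j * fstPart h j) * rot OY z.2 i) D ∧
      ∫ z, (∑ j, rot OX z.1 j * fstPart h j) * rot OY z.2 i ∂D = lam i * fstPart h i := by
    intro i
    have e : ∀ z : Vec d × Vec d, (∑ j, rot OX z.1 j * fstPart h j) * rot OY z.2 i =
        ∑ j, fstPart h j * (rot OX z.1 j * rot OY z.2 i) := fun z => by
      rw [Finset.sum_mul]; exact Finset.sum_congr rfl fun j _ => by ring
    simp_rw [e]
    refine ⟨integrable_finsetSum _ fun j _ => (hint j i).const_mul _, ?_⟩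
    rw [integral_finsetSum _ fun j _ => (hint j i).const_mul _]
    simp_rw [integral_const_mul, hI, Matrix.diagonal_apply]
    simp [mul_comm]
  rcases i with i | i
  · simp only [hebbOp, LinearMap.coe_mk, AddHom.coe_mk, Sum.elim_inl]
    rw [integral_div, integral_add (h1 i).1 (h2 i).1, (h1 i).2, (h2 i).2, fstPart, sndPart]
    ring
  · simp only [hebbOp, LinearMap.coe_mk, AddHom.coe_mk, Sum.elim_inr]
    rw [integral_div, integral_sub (h1 i).1 (h2 i).1, (h1 i).2, (h2 i).2, fstPart, sndPart]
    ring

/-- The mean has spectrum ±λ. The eigenvalue -λ₁ is as large in modulus as the leading one but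
harmless, since the growth factors 1 + η λ_i are compared with their sign. -/
lemma isOjaNoise_hebbOp {D : Measure (Vec d × Vec d)} [IsProbabilityMeasure D]
    (hD : Integrable (fun z : Vec d × Vec d => (‖z.1‖ * ‖z.2‖) ^ 2) D)
    {OX OY : Matrix (Fin d) (Fin d) ℝ} (hOX : OX ∈ Matrix.orthogonalGroup (Fin d) ℝ)
    (hOY : OY ∈ Matrix.orthogonalGroup (Fin d) ℝ) {lam : Fin d → ℝ} (hlam : Antitone lam)
    (hpos : ∀ i, 0 < lam i) {i₀ i₁ : Fin d} (h₀ : i₀.val = 0) (h₁ : i₁.val = 1)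
    (hgap : lam i₁ < lam i₀)
    (hSVD : crossMoment D = OX * Matrix.diagonal lam * OYᵀ) :
    IsOjaNoise D (hebbOp OX OY) (fun z => ‖z.1‖ * ‖z.2‖) (Sum.elim lam fun j => -lam j)
      (Sum.inl i₀) (lam i₁) (∫ z, (‖z.1‖ * ‖z.2‖) ^ 2 ∂D) where
  measurable_A := measurable_hebbOp OX OY
  measurable_n := by fun_prop
  n_nonneg z := by positivity
  norm_le := norm_hebbOp_le hOX hOY
  integrable_sq := hD
  integral_sq_le := le_rfl
  mean := integral_hebbOp hD hOX hOY hSVD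
  l₂_pos := hpos _
  l₂_lt := hgap
  lam_le i hi := by
    rcases i with i | i
    · refine hlam (Fin.le_def.2 (h₁.trans_le (Nat.one_le_iff_ne_zero.2 fun h => hi ?_)))
      exact congrArg Sum.inl (Fin.ext (h.trans h₀.symm))
    · exact (neg_neg_of_pos (hpos i)).le.trans (hpos _).le
  neg_le i := by
    rcases i with i | i
    · exact (neg_neg_of_pos (hpos _)).le.trans (hpos i).le
    · exact neg_le_neg (hlam (Fin.le_def.2 (h₀.trans_le (Nat.zero_le _))))

end Hebbian

/-! ### Number of steps against step size and δ. -/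

section Time

lemma contr_pow_le_exp {l₁ l₂ η : ℝ} (hη : 0 < η) (hl₁ : 0 < l₁) (hl₂ : 0 < l₂) (N : ℕ) :
    contr l₁ l₂ η ^ N ≤ Real.exp (-(2 * (l₁ - l₂) * (N * η) / (1 + η * l₁))) := by
  have h4 : 0 < 1 + η * l₁ := by positivity
  have h1 : (1 + η * l₂) / (1 + η * l₁) ≤ Real.exp (-((l₁ - l₂) * η / (1 + η * l₁))) := by
    have h2 : (1 + η * l₂) / (1 + η * l₁) = -((l₁ - l₂) * η / (1 + η * l₁)) + 1 := by
      field_simp; ring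
    rw [h2]; exact Real.add_one_le_exp _
  calc contr l₁ l₂ η ^ N = ((1 + η * l₂) / (1 + η * l₁)) ^ (2 * N) := by rw [contr, pow_mul]
    _ ≤ Real.exp (-((l₁ - l₂) * η / (1 + η * l₁))) ^ (2 * N) := by gcongr
    _ = _ := by
      rw [← Real.exp_nat_mul]; congr 1; push_cast; ring

/-- The surplus (κ - 1) L, with L the logarithm, is spent in three portions: half on the denominator
1 + η l₁, at most a quarter on rounding T / η down, and a quarter on the gain `Real.exp (-(L₀ * (κ -
1) / 4))`. The rest, exp (-2 L), equals δ⁴ / (1 - δ²)². -/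
lemma contr_pow_floor_le {l₁ l₂ η δ L₀ κ T : ℝ} (hη : 0 < η) (hl₁ : 0 < l₁) (hl₂ : 0 < l₂)
    (hl : l₂ < l₁) (hδ : 0 < δ) (hδ1 : δ < 1) (hL : L₀ ≤ Real.log ((1 - δ ^ 2) / δ ^ 2))
    (hL₀ : 0 < L₀) (hκ : 1 < κ) (hη1 : η * l₁ ≤ 1) (hηκ : η * l₁ ≤ (κ - 1) / 2)
    (hηL : η * (l₁ - l₂) ≤ L₀ * (κ - 1) / 4)
    (hT : κ * (1 / (l₁ - l₂) * Real.log ((1 - δ ^ 2) / δ ^ 2)) ≤ T) :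
    (1 - δ ^ 2) ^ 2 * contr l₁ l₂ η ^ ⌊T / η⌋₊ ≤ Real.exp (-(L₀ * (κ - 1) / 4)) * δ ^ 4 := by
  have hδ2 : 0 < 1 - δ ^ 2 := by nlinarith
  have hg : 0 < l₁ - l₂ := sub_pos.2 hl
  have h4 : 0 < 1 + η * l₁ := by positivity
  set L := Real.log ((1 - δ ^ 2) / δ ^ 2) with hLdef
  have hN : T - η ≤ ⌊T / η⌋₊ * η := by
    have h1 := (Nat.lt_floor_add_one (T / η)).le
    rw [div_le_iff₀ hη] at h1
    linarith
  have hT' : κ * L ≤ (l₁ - l₂) * T := by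
    calc κ * L = (l₁ - l₂) * (κ * (1 / (l₁ - l₂) * L)) := by field_simp
      _ ≤ _ := by gcongr
  have h1 : (L + L₀ * (κ - 1) / 8) * (1 + η * l₁) ≤ (l₁ - l₂) * (⌊T / η⌋₊ * η) := by
    have h2 : (l₁ - l₂) * (T - η) ≤ (l₁ - l₂) * (⌊T / η⌋₊ * η) := by gcongr
    have h3 : L * (η * l₁) ≤ L * ((κ - 1) / 2) := by
      have : 0 ≤ L := hL₀.le.trans hL
      gcongr
    have h5 : L₀ * (κ - 1) ≤ L * (κ - 1) := mul_le_mul_of_nonneg_right hL (by linarith)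
    have h6 : L₀ * (κ - 1) / 8 * (1 + η * l₁) ≤ L₀ * (κ - 1) / 8 * 2 := by
      have : 0 < κ - 1 := by linarith
      gcongr; linarith
    linarith
  rw [← le_div_iff₀ h4] at h1
  have h2 : contr l₁ l₂ η ^ ⌊T / η⌋₊ ≤ Real.exp (-(L₀ * (κ - 1) / 4)) * Real.exp (-(2 * L)) := by
    refine (contr_pow_le_exp hη hl₁ hl₂ _).trans ?_
    rw [← Real.exp_add, Real.exp_le_exp]
    have e : 2 * (l₁ - l₂) * (⌊T / η⌋₊ * η) / (1 + η * l₁) =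
      2 * ((l₁ - l₂) * (⌊T / η⌋₊ * η) / (1 + η * l₁)) := by ring
    rw [e]; linarith
  have h3 : Real.exp (-(2 * L)) = δ ^ 4 / (1 - δ ^ 2) ^ 2 := by
    rw [Real.exp_neg, two_mul, Real.exp_add, hLdef, Real.exp_log (by positivity)]
    field_simp
  rw [h3] at h2
  calc _ ≤ (1 - δ ^ 2) ^ 2 * (Real.exp (-(L₀ * (κ - 1) / 4)) * (δ ^ 4 / (1 - δ ^ 2) ^ 2)) := by
        gcongr
    _ = _ := by field_simp

/-- Crude but sufficient: the time N η is needed only through N η² ≤ K η / δ². -/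
lemma log_ratio_le {δ : ℝ} (hδ : 0 < δ) (hδ1 : δ < 1) :
    Real.log ((1 - δ ^ 2) / δ ^ 2) ≤ 1 / δ ^ 2 := by
  have hδ2 : 0 < 1 - δ ^ 2 := by nlinarith
  have h1 : 0 < (1 - δ ^ 2) / δ ^ 2 := by positivity
  calc _ ≤ (1 - δ ^ 2) / δ ^ 2 := Real.log_le_self h1.le
    _ ≤ _ := by gcongr; linarith [sq_nonneg δ]

/-- From δ ≥ a η ^ μ one has η / δ² ≤ η ^ (1 - 2 μ) / a², and the exponent is positive because μ <
1/2. -/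
lemma div_sq_mul_le_one {η δ a μ R : ℝ} (hη : 0 < η) (ha : 0 < a) (hR : 0 < R) (hμ : μ < 1 / 2)
    (hδ : a * η ^ μ ≤ δ) (hη0 : η ≤ (a ^ 2 / R) ^ (1 / (1 - 2 * μ))) : η / δ ^ 2 * R ≤ 1 := by
  have hx : 0 < 1 - 2 * μ := by linarith
  have h1 : η ^ (1 - 2 * μ) ≤ a ^ 2 / R := by
    calc _ ≤ ((a ^ 2 / R) ^ (1 / (1 - 2 * μ))) ^ (1 - 2 * μ) := by gcongr
      _ = _ := by
        rw [← Real.rpow_mul (by positivity), one_div_mul_cancel hx.ne', Real.rpow_one]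
  have hp : 0 < η ^ μ := Real.rpow_pos_of_pos hη _
  have h2 : η = η ^ (1 - 2 * μ) * (η ^ μ) ^ 2 := by
    rw [← Real.rpow_natCast, ← Real.rpow_mul hη.le, ← Real.rpow_add hη]
    norm_num
    rw [show 1 - 2 * μ + μ * 2 = 1 by ring, Real.rpow_one]
  have h3 : (a * η ^ μ) ^ 2 ≤ δ ^ 2 := by gcongr
  have hδ0 : 0 < δ := (mul_pos ha hp).trans_le hδ
  rw [le_div_iff₀ hR] at h1
  rw [div_mul_eq_mul_div, div_le_one (by positivity)]
  calc η * R = η ^ (1 - 2 * μ) * R * (η ^ μ) ^ 2 := by nth_rewrite 1 [h2]; ring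
    _ ≤ a ^ 2 * (η ^ μ) ^ 2 := by gcongr
    _ = (a * η ^ μ) ^ 2 := by ring
    _ ≤ _ := h3

end Time

end StochGHA

end

/-! ### The escape theorem, assembled. -/

theorem mainTheorem10 {d : ℕ} (hd : 2 ≤ d)
    -- the law of `(X, Y)`, with finite `(4 + Δ)`-th moments
    (D : Measure (StochGHA.Vec d × StochGHA.Vec d)) [IsProbabilityMeasure D]
    (Δ : ℝ) (hΔ : 0 < Δ)
    (hX4 : MemLp (fun z : StochGHA.Vec d × StochGHA.Vec d => z.1) (ENNReal.ofReal (4 + Δ)) D)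
    (hY4 : MemLp (fun z : StochGHA.Vec d × StochGHA.Vec d => z.2) (ENNReal.ofReal (4 + Δ)) D)
    -- a singular value decomposition `Σ_XY = O_X diag(lam) O_Yᵀ`, with `lam 0 > lam 1 ≥ ⋯ > 0`
    (lam : Fin d → ℝ) (hlam : Antitone lam) (hpos : ∀ i, 0 < lam i)
    (hgap : lam ⟨1, by omega⟩ < lam ⟨0, by omega⟩)
    (OX OY : Matrix (Fin d) (Fin d) ℝ)
    (hOX : OX ∈ Matrix.orthogonalGroup (Fin d) ℝ) (hOY : OY ∈ Matrix.orthogonalGroup (Fin d) ℝ)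
    (hSVD : StochGHA.crossMoment D = OX * Matrix.diagonal lam * OYᵀ)
    -- independent samples `(X k, Y k)` with law `D`
    {Ω : Type*} [MeasurableSpace Ω] (Pr : Measure Ω) [IsProbabilityMeasure Pr]
    (X Y : ℕ → Ω → StochGHA.Vec d) (hX : ∀ k, Measurable (X k)) (hY : ∀ k, Measurable (Y k))
    (hlaw : ∀ k, Pr.map (fun ω => (X k ω, Y k ω)) = D)
    (hindep : iIndepFun (fun k ω => (X k ω, Y k ω)) Pr)
    -- the range `[a η ^ μ, b]` of `δ`, and the range `[κ, K]` of the constant in `T₂`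
    (a μ b κ K : ℝ) (ha : 0 < a) (hμ : 0 < μ) (hμ' : μ < 1 / 2)
    (hb : 0 < b) (hb' : b < 1 / Real.sqrt 2) (hκ : 1 < κ) :
    ∃ η₀ : ℝ, 0 < η₀ ∧ ∀ η : ℝ, 0 < η → η < η₀ →
      ∀ δ : ℝ, a * η ^ μ ≤ δ → δ ≤ b →
      ∀ u₀ v₀ : StochGHA.Vec d, ‖u₀‖ = 1 → ‖v₀‖ = 1 →
        StochGHA.hCoord OX OY (u₀, v₀) (Sum.inl ⟨0, by omega⟩) = δ →
      ∀ T₂ : ℝ,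
        κ * (1 / (lam ⟨0, by omega⟩ - lam ⟨1, by omega⟩) * Real.log ((1 - δ ^ 2) / δ ^ 2)) ≤ T₂ →
        T₂ ≤ K * (1 / (lam ⟨0, by omega⟩ - lam ⟨1, by omega⟩) *
          Real.log ((1 - δ ^ 2) / δ ^ 2)) →
        3 / 4 ≤ Pr.real {ω | 1 - δ ^ 2 ≤
          (StochGHA.Hproc OX OY η (fun k => X k ω) (fun k => Y k ω) u₀ v₀ T₂
            (Sum.inl ⟨0, by omega⟩)) ^ 2} := by
  have hD : Integrable (fun z : StochGHA.Vec d × StochGHA.Vec d => (‖z.1‖ * ‖z.2‖) ^ 2) D := by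
    have h4 : (4 : ENNReal) ≤ ENNReal.ofReal (4 + Δ) := by
      rw [show (4 : ENNReal) = ENNReal.ofReal 4 by simp]
      exact ENNReal.ofReal_le_ofReal (by linarith)
    exact StochGHA.integrable_norm_mul_norm_sq (hX4.mono_exponent h4) (hY4.mono_exponent h4)
  have H := StochGHA.isOjaNoise_hebbOp hD hOX hOY hlam hpos rfl rfl hgap hSVD
  have hb2 : b ^ 2 < 1 / 2 := by
    calc b ^ 2 < (1 / Real.sqrt 2) ^ 2 := by gcongr
      _ = 1 / 2 := by rw [div_pow, Real.sq_sqrt (by norm_num), one_pow]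
  set l₁ := lam ⟨0, by omega⟩ with hl₁
  set l₂ := lam ⟨1, by omega⟩ with hl₂
  have hl₁0 : 0 < l₁ := hpos _
  have hl₂0 : 0 < l₂ := hpos _
  have hg : 0 < l₁ - l₂ := sub_pos.2 hgap
  set L₀ := Real.log ((1 - b ^ 2) / b ^ 2) with hL₀
  -- Since b² < 1/2, the logarithm is bounded away from 0 on the whole range of δ; this makes the
  -- slack uniform in δ.
  have hL₀0 : 0 < L₀ := Real.log_pos (by rw [one_lt_div (by positivity)]; linarith)
  set q := L₀ * (κ - 1) / 4 with hq
  have hκ0 : 0 < κ - 1 := by linarith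
  have hq0 : 0 < q := by positivity
  have he : Real.exp (-q) < 1 := Real.exp_lt_one_iff.2 (by linarith)
  have he0 := Real.exp_pos (-q)
  -- This t makes 1 - 4 t equal to the factor exp (-q) gained by κ > 1. The absolute value secures a
  -- nonnegative constant whatever the sign of `K`.
  obtain ⟨R, hR, hmain⟩ := StochGHA.three_fourths_le_ojaIter H
    (t := (1 - Real.exp (-q)) / 4) (K := |K| / (l₁ - l₂)) (by linarith) (by linarith)
    (by positivity) (fun k => (hX k).prodMk (hY k)) hlaw hindep
  refine ⟨min (min (1 / l₁) ((κ - 1) / 2 / l₁))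
    (min (q / (l₁ - l₂)) ((a ^ 2 / R) ^ (1 / (1 - 2 * μ)))), ?_, ?_⟩
  · have := Real.rpow_pos_of_pos (by positivity : 0 < a ^ 2 / R) (1 / (1 - 2 * μ))
    positivity
  intro η hη hη₀ δ hδa hδb u₀ v₀ hu₀ hv₀ hh₀ T₂ hT₁ hT₂
  obtain ⟨h12, h34⟩ := lt_min_iff.1 hη₀
  obtain ⟨h1, h2⟩ := lt_min_iff.1 h12
  obtain ⟨h3, h4⟩ := lt_min_iff.1 h34
  rw [lt_div_iff₀ hl₁0] at h1 h2
  rw [lt_div_iff₀ hg] at h3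
  have hδ : 0 < δ := (mul_pos ha (Real.rpow_pos_of_pos hη μ)).trans_le hδa
  have hδ2 : δ ^ 2 ≤ b ^ 2 := by gcongr
  have hδ1 : δ < 1 := by nlinarith
  have hL : L₀ ≤ Real.log ((1 - δ ^ 2) / δ ^ 2) := by
    apply Real.log_le_log (div_pos (by linarith) (by positivity))
    gcongr
    linarith
  have hL1 : 0 < Real.log ((1 - δ ^ 2) / δ ^ 2) := hL₀0.trans_le hL
  have hT0 : 0 ≤ T₂ := le_trans (by positivity) hT₁
  have hN : ⌊T₂ / η⌋₊ * η ≤ |K| / (l₁ - l₂) / δ ^ 2 := by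
    calc ⌊T₂ / η⌋₊ * η ≤ T₂ := by
          rw [← le_div_iff₀ hη]; exact Nat.floor_le (by positivity)
      _ ≤ K * (1 / (l₁ - l₂) * Real.log ((1 - δ ^ 2) / δ ^ 2)) := hT₂
      _ ≤ |K| * (1 / (l₁ - l₂) * (1 / δ ^ 2)) := by
        gcongr
        · exact le_abs_self K
        · exact StochGHA.log_ratio_le hδ hδ1
      _ = _ := by field_simp
  have hfin := hmain η δ hη hδ (by linarith)
    (StochGHA.div_sq_mul_le_one hη ha hR hμ' hδa h4.le) (StochGHA.hVec OX OY (u₀, v₀))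
    (StochGHA.norm_hVec hOX hOY hu₀ hv₀) hh₀ ⌊T₂ / η⌋₊ hN (by
      refine (StochGHA.contr_pow_floor_le hη hl₁0 hl₂0 hgap hδ hδ1 hL hL₀0 hκ h1.le h2.le h3.le
        hT₁).trans_eq ?_
      ring)
  simp only [← StochGHA.hVec_iter hOX hOY] at hfin
  exact hfin
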